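/- Let $(A,\mathfrak m)$ be a Noetherian local ring with infinite residue field, $M$ a (nonzero, finitely generated) Cohen–Macaulay $A$-module of dimension $r$, and $\mathfrak a$ an ideal of definition for $M$, i.e. a proper ideal of $A$ such that $M/\mathfrak aM$ has finite length. An ideal $\mathfrak c\subseteq\mathfrak a$ is called a reduction of $\mathfrak a$ with respect to $M$ if $\mathfrak c\mathfrak a^nM=\mathfrak a^{n+1}M$ for some $n\ge 0$, and a minimal reduction if it is minimal under inclusion among such reductions. Let $\mathfrak c=(x_1,\dots,x_r)$ be a minimal reduction of $\mathfrak a$ with respect to $M$, and set $$\delta=\sum_{n=0}^{\infty}\ell\!\left(\frac{\mathfrak a^{n+1}M\cap\mathfrak cM}{\mathfrak c\,\mathfrak a^{n}M}\right),$$ where $\ell$ denotes length. If $\delta\in\{0,1,2\}$, then $$\operatorname{depth} G_{\mathfrak a}(M)\ \ge\ r-\delta .$$ Here $G_{\mathfrak a}(M)=\bigoplus_{n\ge 0}\mathfrak a^nM/\mathfrak a^{n+1}M$ is the associated graded module over $G_{\mathfrak a}(A)=\bigoplus_{n\ge0}\mathfrak a^n/\mathfrak a^{n+1}$, and its depth is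 the supremum of the lengths of $G_{\mathfrak a}(M)$-regular sequences contained in the homogeneous maximal ideal $\mathfrak m/\mathfrak a\oplus\bigoplus_{n\ge1}\mathfrak a^n/\mathfrak a^{n+1}$ of $G_{\mathfrak a}(A)$. -/

import Mathlib

open IsLocalRing

namespace AssocGraded

/-- The grade of an ideal `I` on a module `M`: the supremum of the lengths of the `M`-regular
sequences with all terms in `I`. -/
noncomputable def idealGrade {R : Type*} [CommRing R] (I : Ideal R) (M : Type*) [AddCommGroup M]
    [Module R M] : ℕ∞ :=
  ⨆ (rs : List R) (_ : (∀ y ∈ rs, y ∈ I) ∧ RingTheory.Sequence.IsRegular M rs), (rs.length : ℕ∞)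

/-- A finitely generated module `M` over a local ring is Cohen-Macaulay if it is nonzero and its
depth (the grade of the maximal ideal on it) equals its Krull dimension. -/
structure IsCohenMacaulay (A : Type*) [CommRing A] [IsLocalRing A] (M : Type*) [AddCommGroup M]
    [Module A M] : Prop where
  finite : Module.Finite A M
  nontrivial : Nontrivial M
  depth_eq_dim : (idealGrade (maximalIdeal A) M : WithBot ℕ∞) = Module.supportDim A M

/-- A proper ideal `a` of a local ring is an ideal of definition for `M` if `M / aM` has finite
length. -/
def IsIdealOfDefinition {A : Type*} [CommRing A] (a : Ideal A) (M : Type*) [AddCommGroup M]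
    [Module A M] : Prop :=
  a ≠ ⊤ ∧ IsFiniteLength A (M ⧸ (a • ⊤ : Submodule A M))

/-- `c` is a reduction of `a` with respect to `M`: `c ⊆ a` and `c aⁿ M = aⁿ⁺¹ M` for some `n`
(hence for all larger `n`). -/
def IsReduction {A : Type*} [CommRing A] (c a : Ideal A) (M : Type*) [AddCommGroup M]
    [Module A M] : Prop :=
  c ≤ a ∧ ∃ n : ℕ, ((c * a ^ n) • ⊤ : Submodule A M) = a ^ (n + 1) • ⊤

/-- `c` is a minimal reduction of `a` with respect to `M`: it is minimal under inclusion among the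
reductions of `a` with respect to `M`. -/
def IsMinimalReduction {A : Type*} [CommRing A] (c a : Ideal A) (M : Type*) [AddCommGroup M]
    [Module A M] : Prop :=
  Minimal (fun b : Ideal A => IsReduction b a M) c

/-- The associated graded ring `G_a(A) = ⨁ aⁿ/aⁿ⁺¹`, as the quotient `R(a) / a R(a)` of the Rees
algebra `R(a) = ⨁ aⁿ tⁿ`. -/
abbrev GrRing {A : Type*} [CommRing A] (a : Ideal A) : Type _ :=
  reesAlgebra a ⧸ a.map (algebraMap A (reesAlgebra a))

/-- The Rees module `R(a, M) = ⨁ aⁿM tⁿ` over the Rees algebra `R(a)`: the submodule of `M[t]` of all polynomials whose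
coefficient in degree `n` lies in `aⁿM`. -/
def ReesModule {A : Type*} [CommRing A] (a : Ideal A) (M : Type*) [AddCommGroup M]
    [Module A M] : Type _ :=
  ↥(a.stableFiltration (⊤ : Submodule A M)).submodule

noncomputable instance {A : Type*} [CommRing A] (a : Ideal A) (M : Type*) [AddCommGroup M]
    [Module A M] : AddCommGroup (ReesModule a M) :=
  inferInstanceAs (AddCommGroup ↥(a.stableFiltration (⊤ : Submodule A M)).submodule)

noncomputable instance {A : Type*} [CommRing A] (a : Ideal A) (M : Type*) [AddCommGroup M]
    [Module A M] : Module (reesAlgebra a) (ReesModule a M) :=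
  inferInstanceAs (Module (reesAlgebra a) ↥(a.stableFiltration (⊤ : Submodule A M)).submodule)

/-- The associated graded module `G_a(M) = ⨁ aⁿM/aⁿ⁺¹M`, as the quotient `R(a, M) / a R(a, M)` of
the Rees module. It is a module over `G_a(A)`. -/
abbrev GrModule {A : Type*} [CommRing A] (a : Ideal A) (M : Type*) [AddCommGroup M]
    [Module A M] : Type _ :=
  ReesModule a M ⧸
    (a.map (algebraMap A (reesAlgebra a)) • ⊤ : Submodule (reesAlgebra a) (ReesModule a M))

/-- The ideal `m ⊕ a t ⊕ a² t² ⊕ ⋯` of the Rees algebra: all elements whose constant coefficient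
lies in the maximal ideal `m`. -/
noncomputable def reesMaxIdeal {A : Type*} [CommRing A] [IsLocalRing A] (a : Ideal A) :
    Ideal (reesAlgebra a) :=
  (maximalIdeal A).comap (Polynomial.constantCoeff.comp (reesAlgebra a).val.toRingHom)

/-- The homogeneous maximal ideal `m/a ⊕ a/a² ⊕ a²/a³ ⊕ ⋯` of `G_a(A)` (for `a` proper). -/
noncomputable def grMaxIdeal {A : Type*} [CommRing A] [IsLocalRing A] (a : Ideal A) :
    Ideal (GrRing a) :=
  (reesMaxIdeal a).map (Ideal.Quotient.mk (a.map (algebraMap A (reesAlgebra a))))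

/-- `depth G_a(M)`: the grade of the homogeneous maximal ideal of `G_a(A)` on `G_a(M)`. -/
noncomputable def grDepth {A : Type*} [CommRing A] [IsLocalRing A] (a : Ideal A) (M : Type*)
    [AddCommGroup M] [Module A M] : ℕ∞ :=
  idealGrade (R := GrRing a) (grMaxIdeal a) (GrModule a M)

/-- The length of `(aⁿ⁺¹M ∩ cM) / c aⁿ M`. -/
noncomputable def intersectionLength {A : Type*} [CommRing A] (a c : Ideal A) (M : Type*)
    [AddCommGroup M] [Module A M] (n : ℕ) : ℕ∞ :=
  Module.length A (↥(a ^ (n + 1) • ⊤ ⊓ c • ⊤ : Submodule A M) ⧸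
    ((c * a ^ n) • ⊤ : Submodule A M).submoduleOf (a ^ (n + 1) • ⊤ ⊓ c • ⊤))

/-- `δ = ∑_{n ≥ 0} ℓ((aⁿ⁺¹M ∩ cM) / c aⁿ M)`. -/
noncomputable def delta {A : Type*} [CommRing A] (a c : Ideal A) (M : Type*)
    [AddCommGroup M] [Module A M] : ℕ∞ :=
  ∑' n : ℕ, intersectionLength a c M n

end AssocGraded

/-! Write `F n` for `aⁿM`. As the residue field is infinite, `c` is generated by `r` elements
forming a superficial sequence. They are parameters for `M`, because `c` is a reduction of an ideal
of definition, so they form an `M`-regular sequence by the Cohen–Macaulay hypothesis. Call `x`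
initial regular if `x • m ∈ F (n + 1)` forces `m ∈ F n`. If each of the first `r - δ` generators is
initial regular modulo its predecessors, their degree-one forms are a regular sequence on `G_a(M)`.

The number `δ` is the defect of the filtration. Modulo the first generator `x` it drops by a sum of
nonnegative losses (`defect_cons`), so the point is `initialRegular_of_defect_lt`: if the defect is
at most 2 and smaller than the number of generators, the first one is initial regular. Sally's
descent gives this for `x` once the next generator is initial regular modulo `x`, so induction
applies unless the defect modulo `x` is at least the number of remaining generators. In that case
every loss at `x` vanishes and at most three generators are left. Two generators are settled by a
syzygy argument. With three, `x, y, z`, the defect is 2, and the only hard case has defect 1 for `z`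
modulo `x, y` and total loss 1 at `y` modulo `x`.

In the hard case let `L = ⨁ M / F n`. The loss at `y` bounds the length of the socle of `L / xL` by
1 (`sum_socleLength_le`). If `x` were not injective on `L`, consider the last degree `q` in which
the `x`-power torsion of `L` is not inside `xL`; it carries the socle. There `x` maps the torsion
`V` in degree `q` bijectively onto that in degree `q + 1`, so `y/x` and `z/x` act on `V`. Vanishing
losses at `x` force their commutator into the span of one element `c`, itself a value of the
commutator, which generates `V` under both operators. By linear algebra such operators commute
(`commute_of_commutator_mem_span`); hence `c = 0` and `V = 0`, a contradiction. -/

namespace AssocGraded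

/-! ### Operators whose commutator lies in the line of a cyclic vector -/

/-- Over an algebraically closed field, if the commutator of two endomorphisms has image in the
line spanned by a cyclic vector, then the endomorphisms commute. -/
theorem commute_of_commutator_mem_span_of_isAlgClosed {K : Type*} [Field K] [IsAlgClosed K] (n : ℕ) :
    ∀ {V : Type*} [AddCommGroup V] [Module K V] [FiniteDimensional K V]
      (_ : Module.finrank K V = n) (f g : V →ₗ[K] V) (z : V)
      (_ : ∀ v, f (g v) - g (f v) ∈ Submodule.span K {z})
      (_ : ∀ U : Submodule K V, z ∈ U → (∀ u ∈ U, f u ∈ U) → (∀ u ∈ U, g u ∈ U) → U = ⊤) (v : V),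
      f (g v) = g (f v) := by
  induction n using Nat.strong_induction_on with
  | _ n ih =>
  intro V _ _ _ hn f g z hz hgen v
  by_cases hU : ∃ U : Submodule K V, U ≠ ⊥ ∧ U ≠ ⊤ ∧ (∀ u ∈ U, f u ∈ U) ∧ ∀ u ∈ U, g u ∈ U
  -- A proper invariant `U` misses `z`. By induction the operators commute on `V ⧸ U`, so commutator
  -- values lie in `U` and on the line of `z`, hence vanish.
  · obtain ⟨U, hbot, htop, hf, hg⟩ := hU
    have hzU : z ∉ U := fun h ↦ htop (hgen U h hf hg)
    have hlt : Module.finrank K (V ⧸ U) < n := by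
      have h1 := Submodule.finrank_quotient_add_finrank U
      have h2 : Module.finrank K U ≠ 0 := by
        rwa [Ne, Submodule.finrank_eq_zero]
      omega
    have key := ih _ hlt rfl (U.mapQ U f hf) (U.mapQ U g hg) (U.mkQ z) ?_ ?_ (U.mkQ v)
    · have h1 : f (g v) - g (f v) ∈ U := by
        rw [← Submodule.Quotient.eq]
        simpa using key
      obtain ⟨c, hc⟩ := Submodule.mem_span_singleton.1 (hz v)
      by_cases hc0 : c = 0
      · rw [hc0, zero_smul] at hc
        exact sub_eq_zero.1 hc.symm
      · refine absurd ?_ hzU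
        rw [← hc] at h1
        simpa [smul_smul, inv_mul_cancel₀ hc0] using U.smul_mem c⁻¹ h1
    · intro w
      obtain ⟨w, rfl⟩ := U.mkQ_surjective w
      obtain ⟨c, hc⟩ := Submodule.mem_span_singleton.1 (hz w)
      refine Submodule.mem_span_singleton.2 ⟨c, ?_⟩
      rw [← map_smul, hc]
      simp
    · intro W hzW hfW hgW
      have h1 : W.comap U.mkQ = ⊤ :=
        hgen _ hzW (fun u hu ↦ by simpa using hfW _ hu) (fun u hu ↦ by simpa using hgW _ hu)
      rw [eq_top_iff]
      intro w _
      obtain ⟨w, rfl⟩ := U.mkQ_surjective w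
      have : w ∈ W.comap U.mkQ := h1 ▸ Submodule.mem_top
      exact this
  · push Not at hU
    by_contra hv
    have : Nontrivial V := ⟨⟨_, _, hv⟩⟩
    obtain ⟨l, hl⟩ := Module.End.exists_eigenvalue f
    set f' : V →ₗ[K] V := f - l • LinearMap.id with hf'
    have hf'a (u : V) : f' u = f u - l • u := by simp [hf']
    have hker : LinearMap.ker f' ≠ ⊥ := by
      obtain ⟨u, hu⟩ := hl.exists_hasEigenvector
      intro h
      have h2 : u ∈ LinearMap.ker f' := by
        rw [LinearMap.mem_ker, hf'a, hu.apply_eq_smul, sub_self]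
      rw [h, Submodule.mem_bot] at h2
      exact hu.2 h2
    have hinj : ¬ Function.Injective f' := fun h ↦ hker (LinearMap.ker_eq_bot.2 h)
    have hkf (u : V) (hu : f' u = 0) : f u = l • u := by
      rw [hf'a] at hu
      exact sub_eq_zero.1 hu
    have hkt : LinearMap.ker f' ≠ ⊤ := by
      intro h
      have h0 (u : V) : f u = l • u := hkf u (LinearMap.mem_ker.1 (h ▸ Submodule.mem_top))
      exact hv (by rw [h0, h0, map_smul])
    -- The eigenspace is stable under `f`, so by irreducibility not under `g`; a vector `u` leaving
    -- it has a nonzero commutator value `f' (g u)`, which puts `z` in the range of `f'`.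
    obtain ⟨u, hu, hgu⟩ := hU _ hker hkt (fun u hu ↦ by
      rw [LinearMap.mem_ker] at hu ⊢
      rw [hkf u hu, map_smul, hu, smul_zero])
    rw [LinearMap.mem_ker] at hu hgu
    have hzr : z ∈ LinearMap.range f' := by
      obtain ⟨c, hc⟩ := Submodule.mem_span_singleton.1 (hz u)
      have h1 : f (g u) - g (f u) = f' (g u) := by rw [hf'a, hkf u hu, map_smul]
      have hc0 : c ≠ 0 := by
        rintro rfl
        rw [zero_smul, h1] at hc
        exact hgu hc.symm
      refine ⟨c⁻¹ • g u, ?_⟩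
      rw [map_smul, ← h1, ← hc, smul_smul, inv_mul_cancel₀ hc0, one_smul]
    -- Commutator values lie in the range because `z` does, so the range is stable under `g` and
    -- cyclicity makes `f'` onto, against its nonzero kernel.
    have hrange : LinearMap.range f' = ⊤ := by
      refine hgen _ hzr ?_ ?_
      · rintro _ ⟨w, rfl⟩
        exact ⟨f w, by simp [hf'a]⟩
      · rintro _ ⟨w, rfl⟩
        have h1 : g (f' w) = f' (g w) - (f (g w) - g (f w)) := by
          simp only [hf'a, map_sub, map_smul]
          abel
        rw [h1]
        refine sub_mem ⟨_, rfl⟩ ?_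
        exact (Submodule.span_le.2 (Set.singleton_subset_iff.2 hzr)) (hz w)
    exact hinj (LinearMap.injective_iff_surjective.2 (LinearMap.range_eq_top.1 hrange))

/-- Both hypotheses survive base change to the algebraic closure, and `V` embeds into its base
change by faithful flatness. -/
theorem commute_of_commutator_mem_span_of_field {k V : Type*} [Field k] [AddCommGroup V] [Module k V]
    [FiniteDimensional k V] (f g : V →ₗ[k] V) (z : V)
    (hz : ∀ v, f (g v) - g (f v) ∈ Submodule.span k {z})
    (hgen : ∀ U : Submodule k V, z ∈ U → (∀ u ∈ U, f u ∈ U) → (∀ u ∈ U, g u ∈ U) → U = ⊤)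
    (v : V) : f (g v) = g (f v) := by
  let K := AlgebraicClosure k
  open TensorProduct in
  have key := commute_of_commutator_mem_span_of_isAlgClosed (K := K) _ (V := K ⊗[k] V) rfl
    (f.baseChange K) (g.baseChange K) (1 ⊗ₜ z) ?_ ?_ (1 ⊗ₜ v)
  · simp only [LinearMap.baseChange_tmul] at key
    have hinj := Module.FaithfullyFlat.tensorProduct_mk_injective (A := k) (B := K) V
    exact hinj key
  · intro w
    induction w with
    | zero => simp
    | add a b ha hb =>
      have := add_mem ha hb
      simp only [map_add] at this ⊢
      convert this using 1
      abel
    | tmul a b =>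
      obtain ⟨c, hc⟩ := Submodule.mem_span_singleton.1 (hz b)
      refine Submodule.mem_span_singleton.2 ⟨c • a, ?_⟩
      simp only [LinearMap.baseChange_tmul, ← TensorProduct.tmul_sub, ← hc,
        TensorProduct.smul_tmul', TensorProduct.tmul_smul, smul_eq_mul, mul_one]
  · intro U hzU hfU hgU
    have h1 := hgen ((U.restrictScalars k).comap (TensorProduct.mk k K V 1)) hzU
      (fun u hu ↦ by simpa using hfU _ hu) (fun u hu ↦ by simpa using hgU _ hu)
    rw [eq_top_iff]
    intro w _
    induction w with
    | zero => simp
    | add a b ha hb => exact add_mem (ha Submodule.mem_top) (hb Submodule.mem_top)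
    | tmul a b =>
      have h2 : b ∈ (U.restrictScalars k).comap (TensorProduct.mk k K V 1) :=
        h1 ▸ Submodule.mem_top
      have h3 : (1 : K) ⊗ₜ[k] b ∈ U := h2
      simpa [TensorProduct.smul_tmul'] using U.smul_mem a h3

/-- The annihilator of `z` kills everything generated from `z` by `A`-linear operators. So the
maximal ideal kills `V`, and this is a statement over the residue field. -/
theorem commute_of_commutator_mem_span {A V : Type*} [CommRing A] [IsLocalRing A]
    [AddCommGroup V] [Module A V] [Module.Finite A V] (f g : V →ₗ[A] V) (z : V)
    (hz : ∀ v, f (g v) - g (f v) ∈ Submodule.span A {z})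
    (hm : ∀ a ∈ maximalIdeal A, a • z = 0)
    (hgen : ∀ U : Submodule A V, z ∈ U → (∀ u ∈ U, f u ∈ U) → (∀ u ∈ U, g u ∈ U) → U = ⊤)
    (v : V) : f (g v) = g (f v) := by
  have htors : Module.IsTorsionBySet A V (maximalIdeal A : Set A) := by
    intro w a
    have h1 := hgen (LinearMap.ker (LinearMap.lsmul A V a)) (by simpa using hm a a.2)
      (fun u hu ↦ by
        simp only [LinearMap.mem_ker, LinearMap.lsmul_apply] at hu ⊢
        rw [← map_smul, hu, map_zero])
      (fun u hu ↦ by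
        simp only [LinearMap.mem_ker, LinearMap.lsmul_apply] at hu ⊢
        rw [← map_smul, hu, map_zero])
    have h2 : w ∈ LinearMap.ker (LinearMap.lsmul A V a) := h1 ▸ Submodule.mem_top
    simpa using h2
  let _ : Module (ResidueField A) V := htors.module
  have : IsScalarTower A (ResidueField A) V := htors.isScalarTower
  have : FiniteDimensional (ResidueField A) V := Module.Finite.of_restrictScalars_finite A _ _
  have hs : Function.Surjective (algebraMap A (ResidueField A)) := residue_surjective
  let f' : V →ₗ[ResidueField A] V := LinearMap.extendScalarsOfSurjective hs f
  let g' : V →ₗ[ResidueField A] V := LinearMap.extendScalarsOfSurjective hs g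
  refine commute_of_commutator_mem_span_of_field f' g' z ?_ ?_ v
  · intro w
    obtain ⟨c, hc⟩ := Submodule.mem_span_singleton.1 (hz w)
    exact Submodule.mem_span_singleton.2 ⟨algebraMap _ _ c, by rw [algebraMap_smul]; exact hc⟩
  · intro U hzU hfU hgU
    have := hgen (U.restrictScalars A) hzU hfU hgU
    simpa using this

end AssocGraded

/-! ### Initial regular elements, descent, and the torsion of ⨁ M / F n -/

namespace AssocGraded

open Pointwise

variable {A M : Type*} [CommRing A] [AddCommGroup M] [Module A M]

theorem mem_sup_smul_top {X : Submodule A M} {x : A} {m : M} :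
    m ∈ X ⊔ x • (⊤ : Submodule A M) ↔ ∃ f ∈ X, ∃ w : M, m = f + x • w := by
  rw [Submodule.mem_sup]
  constructor
  · rintro ⟨f, hf, g, hg, rfl⟩
    obtain ⟨w, -, rfl⟩ := (Submodule.mem_smul_pointwise_iff_exists _ _ _).1 hg
    exact ⟨f, hf, w, rfl⟩
  · rintro ⟨f, hf, w, rfl⟩
    exact ⟨f, hf, _, Submodule.smul_mem_pointwise_smul _ _ _ Submodule.mem_top, rfl⟩

/-- `x` acts injectively in degree one on the graded module `⨁ M / F n`. -/
def InitialRegular (F : ℕ → Submodule A M) (x : A) : Prop :=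
  ∀ n m, x • m ∈ F (n + 1) → m ∈ F n

/-- `x` acts injectively in degree one on `⨁ M / F n` in all large degrees. -/
def EventuallyInitialRegular (F : ℕ → Submodule A M) (x : A) : Prop :=
  ∃ n₁, ∀ n ≥ n₁, ∀ m, x • m ∈ F (n + 1) → m ∈ F n

/-- The preimage in `M` of the filtration induced by `F` on `M / xM`. -/
def quotFiltration (F : ℕ → Submodule A M) (x : A) (n : ℕ) : Submodule A M :=
  F n ⊔ x • ⊤

theorem mem_quotFiltration {F : ℕ → Submodule A M} {x : A} {n : ℕ} {m : M} :
    m ∈ quotFiltration F x n ↔ ∃ f ∈ F n, ∃ w : M, m = f + x • w :=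
  mem_sup_smul_top

theorem pow_smul_mem {F : ℕ → Submodule A M} {x : A}
    (hx : ∀ n, ∀ m ∈ F n, x • m ∈ F (n + 1)) (n k : ℕ) {m : M} (hm : m ∈ F n) :
    x ^ k • m ∈ F (n + k) := by
  induction k with
  | zero => simpa using hm
  | succ k ih =>
    rw [pow_succ', mul_smul]
    exact hx _ _ ih

theorem InitialRegular.mem_of_pow_smul_mem {F : ℕ → Submodule A M} {x : A}
    (hx : InitialRegular F x) (n k : ℕ) {m : M} (hm : x ^ k • m ∈ F (n + k)) : m ∈ F n := by
  induction k with
  | zero => simpa using hm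
  | succ k ih =>
    rw [pow_succ', mul_smul] at hm
    exact ih (hx _ _ hm)

/-- A form of Sally's descent: if `y` is initial regular modulo `x`, and `x` is initial regular
in large degrees, then `y` is initial regular. -/
theorem InitialRegular.of_quotFiltration {F : ℕ → Submodule A M} {x y : A} (h0 : F 0 = ⊤)
    (hx : ∀ n, ∀ m ∈ F n, x • m ∈ F (n + 1)) (hy : ∀ n, ∀ m ∈ F n, y • m ∈ F (n + 1))
    (hbd : EventuallyInitialRegular F x) (h : InitialRegular (quotFiltration F x) y) :
    ∀ n k m, y ^ k • m ∈ F (n + k) → m ∈ F n := by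
  obtain ⟨n₁, hn₁⟩ := hbd
  intro n
  induction n with
  | zero => intro k m _; rw [h0]; trivial
  | succ n ih =>
    intro k m hm
    obtain ⟨f, hf, w, rfl⟩ := mem_quotFiltration.1 (h.mem_of_pow_smul_mem (n + 1) k (m := m)
      (mem_quotFiltration.2 ⟨_, hm, 0, by simp⟩))
    -- Multiplying by `y ^ n₁` moves the relation for `x • w` into degrees where `x` cancels. This
    -- is why the induction is over all exponents `k`.
    refine add_mem hf (hx _ _ (ih (k + n₁) w ?_))
    refine hn₁ _ (by omega) _ ?_
    have h1 : y ^ k • x • w ∈ F (n + 1 + k) := by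
      have h2 := sub_mem hm (pow_smul_mem hy (n + 1) k hf)
      rwa [smul_add, add_sub_cancel_left] at h2
    have h3 := pow_smul_mem hy _ n₁ h1
    have h4 : n + 1 + k + n₁ = n + (k + n₁) + 1 := by omega
    rwa [smul_smul, ← pow_add, smul_comm, add_comm n₁ k, h4] at h3

/-- After multiplication by `y ^ n₁` the factor `x` cancels for degree reasons; the power of `y`
then cancels by the previous result. -/
theorem InitialRegular.head_of_quotFiltration {F : ℕ → Submodule A M} {x y : A} (h0 : F 0 = ⊤)
    (hx : ∀ n, ∀ m ∈ F n, x • m ∈ F (n + 1)) (hy : ∀ n, ∀ m ∈ F n, y • m ∈ F (n + 1))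
    (hbd : EventuallyInitialRegular F x) (h : InitialRegular (quotFiltration F x) y) :
    InitialRegular F x := by
  have key := InitialRegular.of_quotFiltration h0 hx hy hbd h
  obtain ⟨n₁, hn₁⟩ := hbd
  intro n m hm
  refine key n n₁ m (hn₁ _ (by omega) _ ?_)
  rw [smul_comm]
  convert pow_smul_mem hy _ n₁ hm using 2
  omega

/-- Two generators: if `xM ∩ Fₙ₊₁ ⊆ x Fₙ + y Fₙ + U` for all `n`, then `x` is initial regular. -/
theorem InitialRegular.of_inter_le_two {F : ℕ → Submodule A M} {x y : A} {U : Submodule A M}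
    (h0 : F 0 = ⊤) (hU : ∀ n, U ≤ F n)
    (hy : ∀ n, ∀ m ∈ F n, y • m ∈ F (n + 1))
    (hxU : ∀ m, x • m ∈ U → m ∈ U)
    (hyU : ∀ m, y • m ∈ U ⊔ x • (⊤ : Submodule A M) → m ∈ U ⊔ x • (⊤ : Submodule A M))
    (hD : ∀ n m, x • m ∈ F (n + 1) → ∃ f ∈ F n, ∃ g ∈ F n, ∃ u ∈ U, x • m = x • f + y • g + u) :
    InitialRegular F x := by
  intro n
  induction n with
  | zero => intro m _; rw [h0]; trivial
  | succ n ih =>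
    intro m hm
    obtain ⟨f, hf, g, hg, u, hu, he⟩ := hD _ m hm
    -- The relation shows `y • g ∈ U + xM`, so regularity of `y` writes `g` as `x • w` modulo `U`;
    -- the induction on degree applies to `w`.
    obtain ⟨u', hu', w, hw⟩ := mem_sup_smul_top.1 (hyU g (mem_sup_smul_top.2
      ⟨-u, neg_mem hu, m - f, by
        have : y • g = (x • f + y • g + u) - x • f - u := by module
        rw [this, ← he]; module⟩))
    have hwF : w ∈ F n := by
      refine ih w ?_
      have : x • w = g - u' := by rw [hw]; module
      rw [this]
      exact sub_mem hg (hU _ hu')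
    have h1 : m - f - y • w ∈ U := by
      refine hxU _ ?_
      have : x • (m - f - y • w) = y • u' + u := by
        rw [smul_sub, smul_sub, he, hw]; module
      rw [this]
      exact add_mem (U.smul_mem _ hu') hu
    have : m = (m - f - y • w) + f + y • w := by module
    rw [this]
    exact add_mem (add_mem (hU _ h1) hf) (hy _ _ hwF)

/-- One generator. -/
theorem InitialRegular.of_inter_le_one {F : ℕ → Submodule A M} {x : A} {U : Submodule A M}
    (hU : ∀ n, U ≤ F n) (hxU : ∀ m, x • m ∈ U → m ∈ U)
    (hD : ∀ n m, x • m ∈ F (n + 1) → ∃ f ∈ F n, ∃ u ∈ U, x • m = x • f + u) :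
    InitialRegular F x := by
  intro n m hm
  obtain ⟨f, hf, u, hu, he⟩ := hD _ m hm
  have h1 : m - f ∈ U := hxU _ (by rw [smul_sub, he, add_sub_cancel_left]; exact hu)
  have : m = (m - f) + f := by module
  rw [this]
  exact add_mem (hU _ h1) hf

/-- The elements of `M` whose class in degree `n` of `⨁ M / F n` is killed by a power of `x`. -/
def torsionFiltration (F : ℕ → Submodule A M) (x : A)
    (hx : ∀ n, ∀ m ∈ F n, x • m ∈ F (n + 1)) (n : ℕ) : Submodule A M where
  carrier := {m | ∃ j, x ^ j • m ∈ F (n + j)}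
  zero_mem' := ⟨0, by simp⟩
  add_mem' := by
    rintro a b ⟨i, hi⟩ ⟨j, hj⟩
    refine ⟨i + j, ?_⟩
    rw [smul_add]
    refine add_mem ?_ ?_
    · have := pow_smul_mem hx _ j hi
      rwa [smul_smul, ← pow_add, add_comm j i, add_assoc] at this
    · have := pow_smul_mem hx _ i hj
      rwa [smul_smul, ← pow_add, add_assoc, add_comm j i] at this
  smul_mem' := by
    rintro c a ⟨i, hi⟩
    exact ⟨i, by rw [smul_comm]; exact Submodule.smul_mem _ _ hi⟩

section Core

variable {F : ℕ → Submodule A M} {x : A}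
    (hx : ∀ n, ∀ m ∈ F n, x • m ∈ F (n + 1))

theorem le_torsionFiltration (n : ℕ) : F n ≤ torsionFiltration F x hx n :=
  fun _ hm ↦ ⟨0, by simpa using hm⟩

theorem smul_mem_torsionFiltration_iff {n : ℕ} {m : M} :
    x • m ∈ torsionFiltration F x hx (n + 1) ↔ m ∈ torsionFiltration F x hx n := by
  constructor
  · rintro ⟨j, hj⟩
    refine ⟨j + 1, ?_⟩
    rw [pow_succ, mul_smul]
    convert hj using 2
    omega
  · rintro ⟨j, hj⟩
    refine ⟨j, ?_⟩
    rw [smul_comm]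
    convert hx _ _ hj using 2
    omega

theorem smul_mem_torsionFiltration {y : A} (hy : ∀ n, ∀ m ∈ F n, y • m ∈ F (n + 1)) {n : ℕ} {m : M}
    (hm : m ∈ torsionFiltration F x hx n) : y • m ∈ torsionFiltration F x hx (n + 1) := by
  obtain ⟨j, hj⟩ := hm
  refine ⟨j, ?_⟩
  rw [smul_comm]
  convert hy _ _ hj using 2
  omega

/-- If `x` is initial regular in large degrees but not in all degrees, there is a largest degree
in which the `x`-torsion of `⨁ M / F n` is not contained in the image of `x`. -/
theorem exists_last_torsion (h0 : F 0 = ⊤) (hbd : EventuallyInitialRegular F x)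
    (hnot : ¬ InitialRegular F x) :
    ∃ q, (∃ w ∈ torsionFiltration F x hx q, w ∉ quotFiltration F x q) ∧
      ∀ n, q < n → torsionFiltration F x hx n ≤ quotFiltration F x n := by
  obtain ⟨n₁, hn₁⟩ := hbd
  have hlarge : ∀ n ≥ n₁, torsionFiltration F x hx n ≤ F n := by
    rintro n hn m ⟨j, hj⟩
    induction j with
    | zero => simpa using hj
    | succ j ih =>
      rw [pow_succ', mul_smul] at hj
      exact ih (hn₁ _ (by omega) _ hj)
  let S : Set ℕ := {n | ∃ w ∈ torsionFiltration F x hx n, w ∉ quotFiltration F x n}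
  have hb : BddAbove S := by
    refine ⟨n₁, ?_⟩
    rintro n ⟨w, hw, hw'⟩
    by_contra hn
    exact hw' (mem_quotFiltration.2 ⟨w, hlarge n (by omega) hw, 0, by simp⟩)
  have hne : S.Nonempty := by
    by_contra hS
    have hS' : ∀ n, torsionFiltration F x hx n ≤ quotFiltration F x n := by
      intro n w hw
      by_contra hw'
      exact hS ⟨n, w, hw, hw'⟩
    -- If torsion were always in `F n + xM`, dividing by `x` would give torsion one degree lower,
    -- and induction from `F 0 = ⊤` would kill it all.
    have hall : ∀ n, torsionFiltration F x hx n ≤ F n := by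
      intro n
      induction n with
      | zero => rw [h0]; exact le_top
      | succ n ih =>
        intro w hw
        obtain ⟨f, hf, w', rfl⟩ := mem_quotFiltration.1 (hS' _ hw)
        have h1 : x • w' ∈ torsionFiltration F x hx (n + 1) := by
          have := sub_mem hw (le_torsionFiltration hx _ hf)
          rwa [add_sub_cancel_left] at this
        exact add_mem hf (hx _ _ (ih ((smul_mem_torsionFiltration_iff hx).1 h1)))
    exact hnot fun n m hm ↦ hall n ⟨1, by simpa using hm⟩
  refine ⟨sSup S, Nat.sSup_mem hne hb, fun n hn w hw ↦ ?_⟩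
  by_contra hw'
  exact absurd (le_csSup hb ⟨w, hw, hw'⟩) (by omega)

/-- The three-generator case in which the socle of the filtration modulo `x` has length one. -/
theorem InitialRegular.of_socle_simple [IsLocalRing A] [IsNoetherian A M] (h0 : F 0 = ⊤)
    (hx : ∀ n, ∀ m ∈ F n, x • m ∈ F (n + 1)) {y z : A}
    (hy : ∀ n, ∀ m ∈ F n, y • m ∈ F (n + 1)) (hz : ∀ n, ∀ m ∈ F n, z • m ∈ F (n + 1))
    (hL : ∀ n m, x • m ∈ F (n + 2) → ∃ w g h, z • w - x • g ∈ F (n + 1) ∧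
      y • w + x • h ∈ F (n + 1) ∧ m - y • g - z • h ∈ F (n + 1))
    (hbd : EventuallyInitialRegular F x) (p : ℕ)
    (hE : ∀ n ≠ p, ∀ w, y • w ∈ quotFiltration F x (n + 1) → z • w ∈ quotFiltration F x (n + 1) →
      w ∈ quotFiltration F x n)
    (hEp : ∀ w w₀, y • w ∈ quotFiltration F x (p + 1) → z • w ∈ quotFiltration F x (p + 1) →
      y • w₀ ∈ quotFiltration F x (p + 1) → z • w₀ ∈ quotFiltration F x (p + 1) →
      w₀ ∉ quotFiltration F x p → ∃ s : A, w - s • w₀ ∈ quotFiltration F x p)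
    (hEm : ∀ a ∈ maximalIdeal A, ∀ w, y • w ∈ quotFiltration F x (p + 1) →
      z • w ∈ quotFiltration F x (p + 1) → a • w ∈ quotFiltration F x p) :
    InitialRegular F x := by
  by_contra hnot
  obtain ⟨q, ⟨w₀, hw₀, hw₀'⟩, hq⟩ := exists_last_torsion hx h0 hbd hnot
  set W := torsionFiltration F x hx with hW
  have hWy : ∀ {n m}, m ∈ W n → y • m ∈ W (n + 1) := smul_mem_torsionFiltration hx hy
  have hWz : ∀ {n m}, m ∈ W n → z • m ∈ W (n + 1) := smul_mem_torsionFiltration hx hz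
  have hWx : ∀ {n m}, x • m ∈ W (n + 1) ↔ m ∈ W n := smul_mem_torsionFiltration_iff hx
  have hFW : ∀ n, F n ≤ W n := le_torsionFiltration hx
  have hsoc : ∀ w ∈ W q, y • w ∈ quotFiltration F x (q + 1) ∧ z • w ∈ quotFiltration F x (q + 1) :=
    fun w hw ↦ ⟨hq _ (Nat.lt_succ_self q) (hWy hw), hq _ (Nat.lt_succ_self q) (hWz hw)⟩
  -- By the choice of `q`, the element `w₀` is a nonzero socle element of the quotient by `x`, and
  -- the socle lives only in degree `p`.
  obtain rfl : q = p := by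
    by_contra hqp
    exact hw₀' (hE q hqp w₀ (hsoc _ hw₀).1 (hsoc _ hw₀).2)
  -- away from degree `q + 1`, the kernel of `x` is generated by its previous component
  have hker : ∀ n m, n ≠ q → x • m ∈ F (n + 2) → ∃ g h, x • g ∈ F (n + 1) ∧ x • h ∈ F (n + 1) ∧
      m - y • g - z • h ∈ F (n + 1) := by
    intro n m hn hm
    obtain ⟨w, g, h, h1, h2, h3⟩ := hL n m hm
    obtain ⟨f, hf, w', rfl⟩ := mem_quotFiltration.1 (hE n hn w
      (mem_quotFiltration.2 ⟨_, h2, -h, by module⟩) (mem_quotFiltration.2 ⟨_, h1, g, by module⟩))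
    refine ⟨g - z • w', h + y • w', ?_, ?_, ?_⟩
    · have : x • (g - z • w') = z • f - (z • (f + x • w') - x • g) := by module
      rw [this]
      exact sub_mem (hz _ _ hf) h1
    · have : x • (h + y • w') = (y • (f + x • w') + x • h) - y • f := by module
      rw [this]
      exact sub_mem h2 (hy _ _ hf)
    · convert h3 using 1
      module
  -- The kernel of `x` is zero in degree 0, so generation by the previous component keeps it zero
  -- through degree `q`.
  have hlow : ∀ n ≤ q, ∀ m, x • m ∈ F (n + 1) → m ∈ F n := by
    intro n
    induction n with
    | zero => intro _ m _; rw [h0]; trivial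
    | succ n ih =>
      intro hn m hm
      obtain ⟨g, h, hg, hh, h3⟩ := hker n m (by omega) hm
      have : m = (m - y • g - z • h) + y • g + z • h := by module
      rw [this]
      exact add_mem (add_mem h3 (hy _ _ (ih (by omega) _ hg))) (hz _ _ (ih (by omega) _ hh))
  have hinj : ∀ m, x • m ∈ F (q + 1) → m ∈ F q := hlow q le_rfl
  let V := ↥(W q) ⧸ (F q).submoduleOf (W q)
  let V₁ := ↥(W (q + 1)) ⧸ (F (q + 1)).submoduleOf (W (q + 1))
  let T (a : A) (ha : ∀ m ∈ W q, a • m ∈ W (q + 1)) (ha' : ∀ m ∈ F q, a • m ∈ F (q + 1)) :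
      V →ₗ[A] V₁ :=
    Submodule.mapQ _ _ ((LinearMap.lsmul A M a).restrict ha) fun m hm ↦ ha' _ hm
  let Tx := T x (fun m hm ↦ hWx.2 hm) (hx q)
  let Ty := T y (fun m hm ↦ hWy hm) (hy q)
  let Tz := T z (fun m hm ↦ hWz hm) (hz q)
  have mk_eq : ∀ (a b : M) (ha : a ∈ W q) (hb : b ∈ W q),
      (Submodule.Quotient.mk ⟨a, ha⟩ : V) = Submodule.Quotient.mk ⟨b, hb⟩ ↔ a - b ∈ F q := by
    intro a b ha hb
    rw [Submodule.Quotient.eq]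
    rfl
  have mk_eq₁ : ∀ (a b : M) (ha : a ∈ W (q + 1)) (hb : b ∈ W (q + 1)),
      (Submodule.Quotient.mk ⟨a, ha⟩ : V₁) = Submodule.Quotient.mk ⟨b, hb⟩ ↔
        a - b ∈ F (q + 1) := by
    intro a b ha hb
    rw [Submodule.Quotient.eq]
    rfl
  -- Injectivity is `hinj`. Surjectivity holds because torsion in degree `q + 1` lies in `F (q + 1)
  -- + xM` by maximality of `q`.
  have hTx : Function.Bijective Tx := by
    constructor
    · rw [injective_iff_map_eq_zero]
      intro v hv
      obtain ⟨⟨m, hm⟩, rfl⟩ := Submodule.Quotient.mk_surjective _ v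
      rw [Submodule.Quotient.mk_eq_zero]
      have hv' : (Submodule.Quotient.mk ⟨x • m, hWx.2 hm⟩ : V₁) = 0 := hv
      rw [Submodule.Quotient.mk_eq_zero] at hv'
      exact hinj m hv'
    · intro v
      obtain ⟨⟨m, hm⟩, rfl⟩ := Submodule.Quotient.mk_surjective _ v
      obtain ⟨f, hf, w, rfl⟩ := mem_quotFiltration.1 (hq _ (Nat.lt_succ_self q) hm)
      have hw : w ∈ W q := by
        rw [← hWx]
        have := sub_mem hm (hFW _ hf)
        rwa [add_sub_cancel_left] at this
      refine ⟨Submodule.Quotient.mk ⟨w, hw⟩, ?_⟩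
      refine (mk_eq₁ (x • w) (f + x • w) (hWx.2 hw) hm).2 ?_
      have : x • w - (f + x • w) = -f := by module
      rw [this]
      exact neg_mem hf
  let e : V ≃ₗ[A] V₁ := LinearEquiv.ofBijective Tx hTx
  -- These are the operators `y/x` and `z/x` on the torsion in degree `q`.
  let φ : V →ₗ[A] V := e.symm.toLinearMap ∘ₗ Ty
  let ψ : V →ₗ[A] V := e.symm.toLinearMap ∘ₗ Tz
  have hφ : ∀ w (hw : w ∈ W q) a (ha : a ∈ W q), φ (Submodule.Quotient.mk ⟨w, hw⟩) =
      Submodule.Quotient.mk ⟨a, ha⟩ ↔ y • w - x • a ∈ F (q + 1) := by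
    intro w hw a ha
    change e.symm _ = _ ↔ _
    rw [LinearEquiv.symm_apply_eq]
    exact mk_eq₁ _ _ (hWy hw) (hWx.2 ha)
  have hψ : ∀ w (hw : w ∈ W q) a (ha : a ∈ W q), ψ (Submodule.Quotient.mk ⟨w, hw⟩) =
      Submodule.Quotient.mk ⟨a, ha⟩ ↔ z • w - x • a ∈ F (q + 1) := by
    intro w hw a ha
    change e.symm _ = _ ↔ _
    rw [LinearEquiv.symm_apply_eq]
    exact mk_eq₁ _ _ (hWz hw) (hWx.2 ha)
  have hrep : ∀ v : V, ∃ (a : M) (ha : a ∈ W q), v = Submodule.Quotient.mk ⟨a, ha⟩ := by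
    intro v
    obtain ⟨⟨a, ha⟩, rfl⟩ := Submodule.Quotient.mk_surjective _ v
    exact ⟨a, ha, rfl⟩
  -- the commutator on a representative
  have hcomm : ∀ w (hw : w ∈ W q), ∃ a₂ a₃ c, ∃ (hc : c ∈ W q), a₂ ∈ W q ∧ a₃ ∈ W q ∧
      y • w - x • a₂ ∈ F (q + 1) ∧ z • w - x • a₃ ∈ F (q + 1) ∧
      y • a₃ - z • a₂ - x • c ∈ F (q + 1) ∧
      φ (ψ (Submodule.Quotient.mk ⟨w, hw⟩)) - ψ (φ (Submodule.Quotient.mk ⟨w, hw⟩)) =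
        Submodule.Quotient.mk ⟨c, hc⟩ := by
    intro w hw
    obtain ⟨a₂, ha₂, h2⟩ := hrep (φ (Submodule.Quotient.mk ⟨w, hw⟩))
    obtain ⟨a₃, ha₃, h3⟩ := hrep (ψ (Submodule.Quotient.mk ⟨w, hw⟩))
    obtain ⟨b, hb, hb'⟩ := hrep (φ (Submodule.Quotient.mk ⟨a₃, ha₃⟩))
    obtain ⟨c, hc, hc'⟩ := hrep (ψ (Submodule.Quotient.mk ⟨a₂, ha₂⟩))
    refine ⟨a₂, a₃, b - c, sub_mem hb hc, ha₂, ha₃, (hφ _ _ _ _).1 h2, (hψ _ _ _ _).1 h3, ?_, ?_⟩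
    · have : y • a₃ - z • a₂ - x • (b - c) = (y • a₃ - x • b) - (z • a₂ - x • c) := by module
      rw [this]
      exact sub_mem ((hφ _ _ _ _).1 hb') ((hψ _ _ _ _).1 hc')
    · rw [h2, h3, hb', hc', ← Submodule.Quotient.mk_sub]
      rfl
  obtain ⟨a₂, a₃, c, hc, ha₂, ha₃, h2, h3, hc', hcq⟩ := hcomm w₀ hw₀
  -- In the exceptional degree `q + 1` the kernel of `x` is spanned by `x • c`. The syzygy parameter
  -- `w` is a socle element, hence `s • w₀` up to `F q + xM`; comparison with the syzygy of `w₀`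
  -- leaves only `s` times the commutator.
  have hnext : ∀ m, x • m ∈ F (q + 2) → ∃ s : A, m - s • x • c ∈ F (q + 1) := by
    intro m hm
    obtain ⟨w, g, h, k1, k2, k3⟩ := hL q m hm
    obtain ⟨s, hs⟩ := hEp w w₀ (mem_quotFiltration.2 ⟨_, k2, -h, by module⟩)
      (mem_quotFiltration.2 ⟨_, k1, g, by module⟩) (hsoc _ hw₀).1 (hsoc _ hw₀).2 hw₀'
    obtain ⟨f, hf, w', hw'⟩ := mem_quotFiltration.1 hs
    obtain rfl : w = s • w₀ + f + x • w' := by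
      have : w = (w - s • w₀) + s • w₀ := by module
      rw [this, hw']; module
    refine ⟨s, ?_⟩
    have hg : g - s • a₃ - z • w' ∈ F q := by
      refine hinj _ ?_
      have : x • (g - s • a₃ - z • w') =
          s • (z • w₀ - x • a₃) + z • f - (z • (s • w₀ + f + x • w') - x • g) := by module
      rw [this]
      exact sub_mem (add_mem (Submodule.smul_mem _ _ h3) (hz _ _ hf)) k1
    have hh : h + s • a₂ + y • w' ∈ F q := by
      refine hinj _ ?_
      have : x • (h + s • a₂ + y • w') =
          (y • (s • w₀ + f + x • w') + x • h) - s • (y • w₀ - x • a₂) - y • f := by module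
      rw [this]
      exact sub_mem (sub_mem k2 (Submodule.smul_mem _ _ h2)) (hy _ _ hf)
    have : m - s • x • c = (m - y • g - z • h) + y • (g - s • a₃ - z • w') +
        z • (h + s • a₂ + y • w') + s • (y • a₃ - z • a₂ - x • c) := by module
    rw [this]
    exact add_mem (add_mem (add_mem k3 (hy _ _ hg)) (hz _ _ hh)) (Submodule.smul_mem _ _ hc')
  have hspan : ∀ v, φ (ψ v) - ψ (φ v) ∈
      Submodule.span A {(Submodule.Quotient.mk ⟨c, hc⟩ : V)} := by
    intro v
    obtain ⟨w, hw, rfl⟩ := hrep v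
    obtain ⟨b₂, b₃, d, hd, hb₂, hb₃, k2, k3, hd', hdq⟩ := hcomm w hw
    rw [hdq]
    -- A commutator value `d` satisfies `x • x • d ∈ F (q + 2)`, because `y` and `z` commute on `M`.
    obtain ⟨s, hs⟩ := hnext (x • d) (by
      have : x • x • d = y • (x • b₃ - z • w) - z • (x • b₂ - y • w) -
          x • (y • b₃ - z • b₂ - x • d) := by module
      rw [this]
      refine sub_mem (sub_mem (hy _ _ ?_) (hz _ _ ?_)) (hx _ _ hd')
      · rw [← neg_sub]; exact neg_mem k3
      · rw [← neg_sub]; exact neg_mem k2)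
    refine Submodule.mem_span_singleton.2 ⟨s, ?_⟩
    refine (mk_eq (s • c) d (Submodule.smul_mem _ _ hc) hd).2 ?_
    rw [← neg_sub]
    refine neg_mem (hinj _ ?_)
    rwa [smul_sub, smul_comm x s c]
  have hmax : ∀ a ∈ maximalIdeal A, a • (Submodule.Quotient.mk ⟨c, hc⟩ : V) = 0 := by
    intro a ha
    obtain ⟨f, hf, w', hw'⟩ := mem_quotFiltration.1 (hEm a ha w₀ (hsoc _ hw₀).1 (hsoc _ hw₀).2)
    have k3 : a • a₃ - z • w' ∈ F q := by
      refine hinj _ ?_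
      have : x • (a • a₃ - z • w') = z • (a • w₀ - x • w') - a • (z • w₀ - x • a₃) := by module
      rw [this, hw', add_sub_cancel_right]
      exact sub_mem (hz _ _ hf) (Submodule.smul_mem _ _ h3)
    have k2 : a • a₂ - y • w' ∈ F q := by
      refine hinj _ ?_
      have : x • (a • a₂ - y • w') = y • (a • w₀ - x • w') - a • (y • w₀ - x • a₂) := by module
      rw [this, hw', add_sub_cancel_right]
      exact sub_mem (hy _ _ hf) (Submodule.smul_mem _ _ h2)
    rw [← Submodule.Quotient.mk_smul, Submodule.Quotient.mk_eq_zero]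
    refine hinj (a • c) ?_
    have : x • a • c = y • (a • a₃ - z • w') - z • (a • a₂ - y • w') -
        a • (y • a₃ - z • a₂ - x • c) := by module
    rw [this]
    exact sub_mem (sub_mem (hy _ _ k3) (hz _ _ k2)) (Submodule.smul_mem _ _ hc')
  have hgen : ∀ U : Submodule A V, (Submodule.Quotient.mk ⟨c, hc⟩ : V) ∈ U →
      (∀ u ∈ U, φ u ∈ U) → (∀ u ∈ U, ψ u ∈ U) → U = ⊤ := by
    intro U hcU hφU hψU
    -- The kernel of `x` in degree `q + j` comes from `x ^ j • U`. It starts with `x • c` at `j = 1`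
    -- and is propagated by `hker`, where `y` and `z` act on `x ^ j • V` as `x ^ (j + 1)` times `φ`
    -- and `ψ`.
    have hD : ∀ j m, x • m ∈ F (q + j + 1) → ∃ v, ∃ hv : v ∈ W q,
        (Submodule.Quotient.mk ⟨v, hv⟩ : V) ∈ U ∧ m - x ^ j • v ∈ F (q + j) := by
      intro j
      induction j with
      | zero =>
        intro m hm
        refine ⟨0, zero_mem _, U.zero_mem, ?_⟩
        simpa using hinj m hm
      | succ j ih =>
        intro m hm
        rcases Nat.eq_zero_or_pos j with rfl | hj
        · obtain ⟨s, hs⟩ := hnext m hm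
          refine ⟨s • c, Submodule.smul_mem _ _ hc, U.smul_mem s hcU, ?_⟩
          rwa [zero_add, pow_one, smul_comm]
        · obtain ⟨g, h, hg, hh, hm'⟩ := hker (q + j) m (by omega) hm
          obtain ⟨v, hv, hvU, hgv⟩ := ih g hg
          obtain ⟨u, hu, huU, hhu⟩ := ih h hh
          obtain ⟨v', hv', hv''⟩ := hrep (φ (Submodule.Quotient.mk ⟨v, hv⟩))
          obtain ⟨u', hu', hu''⟩ := hrep (ψ (Submodule.Quotient.mk ⟨u, hu⟩))
          refine ⟨v' + u', add_mem hv' hu', ?_, ?_⟩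
          · have := U.add_mem (hφU _ hvU) (hψU _ huU)
            rw [hv'', hu''] at this
            exact this
          · have : m - x ^ (j + 1) • (v' + u') = (m - y • g - z • h) + y • (g - x ^ j • v) +
                z • (h - x ^ j • u) + x ^ j • (y • v - x • v') + x ^ j • (z • u - x • u') := by
              rw [pow_succ]; module
            rw [this]
            refine add_mem (add_mem (add_mem (add_mem hm' (hy _ _ hgv)) (hz _ _ hhu)) ?_) ?_
            · convert pow_smul_mem hx _ j ((hφ _ _ _ _).1 hv'') using 2
              omega
            · convert pow_smul_mem hx _ j ((hψ _ _ _ _).1 hu'') using 2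
              omega
    -- Torsion elements are caught by induction on the power of `x` that kills them: modulo `U`, the
    -- exponent can be lowered by one.
    have hE' : ∀ j w (hw : w ∈ W q), x ^ j • w ∈ F (q + j) →
        (Submodule.Quotient.mk ⟨w, hw⟩ : V) ∈ U := by
      intro j
      induction j with
      | zero =>
        intro w hw hj
        have : (Submodule.Quotient.mk ⟨w, hw⟩ : V) = 0 := by
          rw [Submodule.Quotient.mk_eq_zero]
          rw [pow_zero, one_smul] at hj
          exact hj
        rw [this]
        exact U.zero_mem
      | succ j ih =>
        intro w hw hj
        rw [pow_succ', mul_smul] at hj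
        obtain ⟨v, hv, hvU, hwv⟩ := hD j _ hj
        rw [← smul_sub] at hwv
        have := U.add_mem (ih (w - v) (sub_mem hw hv) hwv) hvU
        rw [← Submodule.Quotient.mk_add] at this
        convert this using 2
        simp
    rw [eq_top_iff]
    intro v _
    obtain ⟨w, hw, rfl⟩ := hrep v
    obtain ⟨j, hj⟩ := id hw
    exact hE' j w hw hj
  have hzero := commute_of_commutator_mem_span φ ψ _ hspan hmax hgen
    (Submodule.Quotient.mk ⟨w₀, hw₀⟩)
  rw [← sub_eq_zero, hcq] at hzero
  have htop := hgen ⊥ (by rw [hzero]; exact zero_mem _) (by simp) (by simp)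
  have hw : (Submodule.Quotient.mk ⟨w₀, hw₀⟩ : V) ∈ (⊥ : Submodule A V) := by
    rw [htop]; trivial
  rw [Submodule.mem_bot, Submodule.Quotient.mk_eq_zero] at hw
  exact hw₀' (mem_quotFiltration.2 ⟨w₀, hw, 0, by simp⟩)

end Core

end AssocGraded

/-! ### Lengths of subquotients -/

namespace AssocGraded

open Pointwise

theorem enat_summable {ι : Type*} (f : ι → ℕ∞) : Summable f :=
  ⟨_, hasSum_of_isLUB _ isLUB_iSup⟩

section RelLength

variable {A M : Type*} [CommRing A] [AddCommGroup M] [Module A M]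

/-- The length of `X / (X ∩ Y)`. -/
noncomputable def relLength (X Y : Submodule A M) : ℕ∞ :=
  Module.length A (↥X ⧸ Y.submoduleOf X)

theorem relLength_eq_zero_iff {X Y : Submodule A M} : relLength X Y = 0 ↔ X ≤ Y := by
  rw [relLength, Module.length_eq_zero_iff, Submodule.Quotient.subsingleton_iff,
    Submodule.submoduleOf_eq_top]

/-- The map `X → (f(X) + Y) / Y` is onto with kernel `X ∩ f⁻¹(Y)`. -/
theorem relLength_map_sup (f : M →ₗ[A] M) (X Y : Submodule A M) :
    relLength (X.map f ⊔ Y) Y = relLength X (Y.comap f) := by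
  let g : X →ₗ[A] (↥(X.map f ⊔ Y) ⧸ Y.submoduleOf (X.map f ⊔ Y)) :=
    (Submodule.mkQ _).comp (f.restrict (p := X) (q := X.map f ⊔ Y)
      fun x hx ↦ (le_sup_left : X.map f ≤ _) (Submodule.mem_map_of_mem hx))
  have hg : Function.Surjective g := by
    intro v
    obtain ⟨⟨m, hm⟩, rfl⟩ := Submodule.Quotient.mk_surjective _ v
    obtain ⟨_, ⟨a, ha, rfl⟩, b, hb, rfl⟩ := Submodule.mem_sup.1 hm
    refine ⟨⟨a, ha⟩, ?_⟩
    refine (Submodule.Quotient.eq _).2 ?_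
    change f a - (f a + b) ∈ Y
    simpa using hb
  have hk : LinearMap.ker g = (Y.comap f).submoduleOf X := by
    ext ⟨m, hm⟩
    rw [LinearMap.mem_ker]
    exact Submodule.Quotient.mk_eq_zero _
  rw [relLength, relLength, ← hk]
  exact (g.quotKerEquivOfSurjective hg).length_eq.symm

theorem relLength_sup (X Y : Submodule A M) : relLength (X ⊔ Y) Y = relLength X Y := by
  simpa using relLength_map_sup LinearMap.id X Y

theorem relLength_inf (X Y : Submodule A M) : relLength X (X ⊓ Y) = relLength X Y := by
  have : (X ⊓ Y).submoduleOf X = Y.submoduleOf X := by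
    ext ⟨m, hm⟩
    exact ⟨fun h ↦ h.2, fun h ↦ ⟨hm, h⟩⟩
  rw [relLength, relLength, this]

theorem relLength_add {X Y Z : Submodule A M} (hXY : Y ≤ X) (hYZ : Z ≤ Y) :
    relLength X Z = relLength X Y + relLength Y Z := by
  let f : (↥Y ⧸ Z.submoduleOf Y) →ₗ[A] (↥X ⧸ Z.submoduleOf X) :=
    Submodule.mapQ _ _ (Submodule.inclusion hXY) fun _ h ↦ h
  let g : (↥X ⧸ Z.submoduleOf X) →ₗ[A] (↥X ⧸ Y.submoduleOf X) :=
    Submodule.mapQ _ _ LinearMap.id fun _ h ↦ hYZ h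
  have hf : Function.Injective f := by
    rw [injective_iff_map_eq_zero]
    intro v hv
    obtain ⟨⟨m, hm⟩, rfl⟩ := Submodule.Quotient.mk_surjective _ v
    rw [Submodule.Quotient.mk_eq_zero]
    have hv' : (Submodule.Quotient.mk ⟨m, hXY hm⟩ : ↥X ⧸ Z.submoduleOf X) = 0 := hv
    exact (Submodule.Quotient.mk_eq_zero (Z.submoduleOf X)).1 hv'
  have hg : Function.Surjective g := by
    intro v
    obtain ⟨m, rfl⟩ := Submodule.Quotient.mk_surjective _ v
    exact ⟨Submodule.Quotient.mk m, rfl⟩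
  have he : Function.Exact f g := by
    intro v
    obtain ⟨⟨m, hm⟩, rfl⟩ := Submodule.Quotient.mk_surjective _ v
    constructor
    · intro h
      have hv' : (Submodule.Quotient.mk ⟨m, hm⟩ : ↥X ⧸ Y.submoduleOf X) = 0 := h
      have h' : m ∈ Y := (Submodule.Quotient.mk_eq_zero (Y.submoduleOf X)).1 hv'
      exact ⟨Submodule.Quotient.mk ⟨m, h'⟩, rfl⟩
    · rintro ⟨w, hw⟩
      obtain ⟨⟨w, hw'⟩, rfl⟩ := Submodule.Quotient.mk_surjective _ w
      rw [← hw]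
      exact (Submodule.Quotient.mk_eq_zero (Y.submoduleOf X) (x := ⟨w, hXY hw'⟩)).2 hw'
  rw [relLength, relLength, relLength, Module.length_eq_add_of_exact f g hf hg he, add_comm]

theorem relLength_anti (X : Submodule A M) {Y Z : Submodule A M} (h : X ⊓ Z ≤ Y) :
    relLength X Y ≤ relLength X Z := by
  rw [← relLength_inf X Z, ← relLength_inf X Y,
    relLength_add (inf_le_left : X ⊓ Y ≤ X) (le_inf inf_le_left h)]
  exact le_self_add

theorem relLength_mono {X X' : Submodule A M} (h : X ≤ X') (Y : Submodule A M) :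
    relLength X Y ≤ relLength X' Y := by
  rw [← relLength_sup X, ← relLength_sup X',
    relLength_add (sup_le_sup_right h Y) le_sup_right]
  exact le_add_self

theorem exists_smul_sub_mem_of_relLength_le_one {X Y : Submodule A M} (h : relLength X Y ≤ 1)
    {w w₀ : M} (hw : w ∈ X) (hw₀ : w₀ ∈ X) (hw₀' : w₀ ∉ Y) : ∃ s : A, w - s • w₀ ∈ Y := by
  have h1 : Module.length A (↥X ⧸ Y.submoduleOf X) = 1 := by
    refine le_antisymm h ?_
    rw [Order.one_le_iff_pos, pos_iff_ne_zero]
    intro h0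
    exact hw₀' (relLength_eq_zero_iff.1 h0 hw₀)
  have hs := Module.length_eq_one_iff.1 h1
  have hne : (Submodule.Quotient.mk ⟨w₀, hw₀⟩ : ↥X ⧸ Y.submoduleOf X) ≠ 0 := by
    rw [Ne, Submodule.Quotient.mk_eq_zero]
    exact hw₀'
  obtain ⟨s, hs⟩ := IsSimpleModule.toSpanSingleton_surjective A hne
    (Submodule.Quotient.mk ⟨w, hw⟩)
  refine ⟨s, ?_⟩
  have h2 : (Submodule.Quotient.mk ⟨w, hw⟩ : ↥X ⧸ Y.submoduleOf X) =
      Submodule.Quotient.mk (s • ⟨w₀, hw₀⟩) := hs.symm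
  exact (Submodule.Quotient.eq (Y.submoduleOf X)).1 h2

/-- If `a • w` were nonzero modulo `Y` it would generate, so `w ≡ s a w`; but `1 - s a` is a unit.
-/
theorem smul_mem_of_relLength_le_one [IsLocalRing A] {X Y : Submodule A M}
    (h : relLength X Y ≤ 1) {a : A} (ha : a ∈ maximalIdeal A) {w : M} (hw : w ∈ X) :
    a • w ∈ Y := by
  by_contra haw
  obtain ⟨s, hs⟩ := exists_smul_sub_mem_of_relLength_le_one h hw (X.smul_mem a hw) haw
  have hu : IsUnit (1 - s * a) := by
    by_contra hn
    have := add_mem ((mem_maximalIdeal _).2 hn) (Ideal.mul_mem_left _ s ha)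
    rw [sub_add_cancel] at this
    exact (Ideal.ne_top_iff_one _).1 (maximalIdeal.isMaximal A).ne_top this
  have h1 : (1 - s * a) • w ∈ Y := by
    convert hs using 1
    module
  exact haw (Y.smul_mem a ((Y.smul_mem_iff_of_isUnit hu).1 h1))

end RelLength

/-! ### The defect and its behaviour modulo one generator -/

section Defect

variable {A M : Type*} [CommRing A] [AddCommGroup M] [Module A M]

/-- The length of `(Fₙ₊₁ ∩ (xs)M) / (xs) Fₙ`, computed modulo the submodule `U`. -/
noncomputable def gap (U : Submodule A M) (F : ℕ → Submodule A M) (xs : List A) (n : ℕ) : ℕ∞ :=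
  relLength (F (n + 1) ⊓ (Ideal.ofList xs • ⊤ ⊔ U)) (Ideal.ofList xs • F n ⊔ U)

/-- The sum of the lengths of `(Fₙ₊₁ ∩ (xs)M) / (xs) Fₙ`, computed modulo `U`. -/
noncomputable def defect (U : Submodule A M) (F : ℕ → Submodule A M) (xs : List A) : ℕ∞ :=
  ∑' n, gap U F xs n

/-- The filtrations for which the defect is considered: `F` is exhaustive, contains `U`, and each
member of the list `xs` raises the degree by one. -/
structure IsAdapted (U : Submodule A M) (F : ℕ → Submodule A M) (xs : List A) : Prop where
  zero : F 0 = ⊤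
  le : ∀ n, U ≤ F n
  smul_mem : ∀ x ∈ xs, ∀ n, ∀ m ∈ F n, x • m ∈ F (n + 1)

/-- Each member of the list is regular and initial regular in large degrees modulo the
preceding ones. -/
def IsSuperficialSeq : List A → Submodule A M → (ℕ → Submodule A M) → Prop
  | [], _, _ => True
  | x :: xs, U, F => (∀ m, x • m ∈ U → m ∈ U) ∧ EventuallyInitialRegular F x ∧
      IsSuperficialSeq xs (U ⊔ x • ⊤) (quotFiltration F x)

variable {U : Submodule A M} {F : ℕ → Submodule A M} {x y z : A} {xs : List A}

theorem IsAdapted.quot (h : IsAdapted U F (x :: xs)) :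
    IsAdapted (U ⊔ x • ⊤) (quotFiltration F x) xs where
  zero := by rw [quotFiltration, h.zero, top_sup_eq]
  le n := sup_le_sup_right (h.le n) _
  smul_mem := by
    intro a ha n m hm
    obtain ⟨f, hf, w, rfl⟩ := mem_quotFiltration.1 hm
    exact mem_quotFiltration.2 ⟨a • f, h.smul_mem a (by simp [ha]) n f hf, a • w, by module⟩

theorem ofList_cons_smul_sup (X : Submodule A M) :
    Ideal.ofList (x :: xs) • X ⊔ U = (x • X ⊔ U) ⊔ Ideal.ofList xs • X := by
  rw [Ideal.ofList_cons_smul, sup_right_comm]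

theorem ofList_smul_quot_sup (X : Submodule A M) :
    Ideal.ofList xs • (X ⊔ x • ⊤) ⊔ (U ⊔ x • ⊤) =
      (Ideal.ofList (x :: xs) • X ⊔ U) ⊔ x • (⊤ : Submodule A M) := by
  rw [ofList_cons_smul_sup, Submodule.smul_sup]
  have h1 : Ideal.ofList xs • x • (⊤ : Submodule A M) ≤ x • ⊤ := Submodule.smul_le_right
  have h2 : x • X ≤ x • (⊤ : Submodule A M) := smul_mono_right _ le_top
  apply le_antisymm
  · refine sup_le (sup_le ?_ (h1.trans le_sup_right)) (sup_le ?_ le_sup_right)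
    · exact le_sup_right.trans le_sup_left
    · exact (le_sup_right.trans le_sup_left).trans le_sup_left
  · refine sup_le (sup_le (sup_le ?_ ?_) ?_) ?_
    · exact h2.trans (le_sup_right.trans le_sup_right)
    · exact le_sup_left.trans le_sup_right
    · exact le_sup_left.trans le_sup_left
    · exact le_sup_right.trans le_sup_right

/-- The loss of length in the passage from `gap U F (x :: xs)` to the filtration modulo `x`. -/
noncomputable def gapLoss (U : Submodule A M) (F : ℕ → Submodule A M) (x : A) (xs : List A)
    (n : ℕ) : ℕ∞ :=
  relLength (F (n + 1) ⊓ ((Ideal.ofList (x :: xs) • F n ⊔ U) ⊔ x • (⊤ : Submodule A M)))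
    (Ideal.ofList (x :: xs) • F n ⊔ U)

theorem smul_top_le_ofList_cons_smul_sup :
    x • (⊤ : Submodule A M) ≤ Ideal.ofList (x :: xs) • ⊤ ⊔ U := by
  rw [ofList_cons_smul_sup]
  exact le_sup_left.trans le_sup_left

theorem IsAdapted.ofList_smul_le (h : IsAdapted U F xs) (n : ℕ) :
    Ideal.ofList xs • F n ⊔ U ≤ F (n + 1) := by
  refine sup_le ?_ (h.le _)
  rw [Ideal.ofList, Submodule.smul_le]
  intro r hr m hm
  induction hr using Submodule.span_induction with
  | mem a ha => exact h.smul_mem a ha n m hm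
  | zero => simp
  | add a b _ _ ha hb => rw [add_smul]; exact add_mem ha hb
  | smul a b _ hb => rw [smul_assoc]; exact Submodule.smul_mem _ _ hb

/-- By the modular law the gap modulo `x` is the length of `F (n + 1) ∩ B` over its intersection
with `Y + xM`, where `B` is `(x, xs)M + U` and `Y` is `(x, xs) F n + U`. The loss is the remaining
layer down to `Y`. -/
theorem gap_cons (h : IsAdapted U F (x :: xs)) (n : ℕ) :
    gap U F (x :: xs) n = gap (U ⊔ x • ⊤) (quotFiltration F x) xs n + gapLoss U F x xs n := by
  have e1 : Ideal.ofList xs • (⊤ : Submodule A M) ⊔ (U ⊔ x • ⊤) =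
      Ideal.ofList (x :: xs) • (⊤ : Submodule A M) ⊔ U := by
    have := ofList_smul_quot_sup (U := U) (x := x) (xs := xs) (⊤ : Submodule A M)
    rwa [top_sup_eq, sup_eq_left.2 (smul_top_le_ofList_cons_smul_sup (x := x) (xs := xs) (U := U))] at this
  have e2 : Ideal.ofList xs • quotFiltration F x n ⊔ (U ⊔ x • ⊤) =
      (Ideal.ofList (x :: xs) • F n ⊔ U) ⊔ x • (⊤ : Submodule A M) := ofList_smul_quot_sup (F n)
  rw [gap, gap, gapLoss, e1, e2, quotFiltration]
  set B := Ideal.ofList (x :: xs) • (⊤ : Submodule A M) ⊔ U with hB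
  set Y := Ideal.ofList (x :: xs) • F n ⊔ U with hY
  have hQB : x • (⊤ : Submodule A M) ≤ B := smul_top_le_ofList_cons_smul_sup
  have hYB : Y ≤ B := sup_le_sup_right (smul_mono_right _ le_top) U
  have hYF : Y ≤ F (n + 1) := h.ofList_smul_le n
  have hY'B : Y ⊔ x • ⊤ ≤ B := sup_le hYB hQB
  have e3 : F (n + 1) ⊓ (Y ⊔ x • ⊤) = (F (n + 1) ⊓ B) ⊓ (Y ⊔ x • ⊤) := by
    rw [inf_assoc, inf_eq_right.2 hY'B]
  have e4 : (F (n + 1) ⊔ x • ⊤) ⊓ B = (F (n + 1) ⊓ B) ⊔ (Y ⊔ x • ⊤) := by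
    rw [← sup_assoc, sup_eq_left.2 (le_inf hYF hYB), sup_comm (F (n + 1)),
      sup_inf_assoc_of_le _ hQB, sup_comm]
  rw [e3, e4, relLength_sup, ← relLength_inf (F (n + 1) ⊓ B) (Y ⊔ x • ⊤)]
  exact relLength_add inf_le_left (le_inf (le_inf hYF hYB) le_sup_left)

theorem defect_cons (h : IsAdapted U F (x :: xs)) :
    defect U F (x :: xs) =
      defect (U ⊔ x • ⊤) (quotFiltration F x) xs + ∑' n, gapLoss U F x xs n := by
  rw [defect, defect, ← (enat_summable _).tsum_add (enat_summable _)]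
  exact tsum_congr (gap_cons h)

theorem mem_of_gapLoss_eq_zero {n : ℕ} (h : gapLoss U F x xs n = 0) {m : M}
    (hm : x • m ∈ F (n + 1)) : x • m ∈ Ideal.ofList (x :: xs) • F n ⊔ U :=
  relLength_eq_zero_iff.1 h ⟨hm, (le_sup_right : x • (⊤ : Submodule A M) ≤ _)
    (Submodule.smul_mem_pointwise_smul _ _ _ Submodule.mem_top)⟩

theorem mem_ofList_singleton_smul_sup {X : Submodule A M} {m : M} :
    m ∈ Ideal.ofList [x] • X ⊔ U ↔ ∃ f ∈ X, ∃ u ∈ U, m = x • f + u := by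
  simp only [Ideal.ofList_cons_smul, Ideal.ofList_nil, Submodule.bot_smul, sup_bot_eq,
    Submodule.mem_sup, Submodule.mem_smul_pointwise_iff_exists]
  constructor
  · rintro ⟨_, ⟨f, hf, rfl⟩, u, hu, rfl⟩
    exact ⟨f, hf, u, hu, rfl⟩
  · rintro ⟨f, hf, u, hu, rfl⟩
    exact ⟨_, ⟨f, hf, rfl⟩, u, hu, rfl⟩

theorem mem_ofList_pair_smul_sup {X : Submodule A M} {m : M} :
    m ∈ Ideal.ofList [x, y] • X ⊔ U ↔
      ∃ f ∈ X, ∃ g ∈ X, ∃ u ∈ U, m = x • f + y • g + u := by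
  simp only [Ideal.ofList_cons_smul, Ideal.ofList_nil, Submodule.bot_smul, sup_bot_eq,
    Submodule.mem_sup, Submodule.mem_smul_pointwise_iff_exists]
  constructor
  · rintro ⟨_, ⟨_, ⟨f, hf, rfl⟩, _, ⟨g, hg, rfl⟩, rfl⟩, u, hu, rfl⟩
    exact ⟨f, hf, g, hg, u, hu, rfl⟩
  · rintro ⟨f, hf, g, hg, u, hu, rfl⟩
    exact ⟨_, ⟨_, ⟨f, hf, rfl⟩, _, ⟨g, hg, rfl⟩, rfl⟩, u, hu, rfl⟩

theorem mem_ofList_triple_smul_sup {X : Submodule A M} {m : M} :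
    m ∈ Ideal.ofList [x, y, z] • X ⊔ U ↔
      ∃ f ∈ X, ∃ g ∈ X, ∃ h ∈ X, ∃ u ∈ U, m = x • f + y • g + z • h + u := by
  simp only [Ideal.ofList_cons_smul, Ideal.ofList_nil, Submodule.bot_smul, sup_bot_eq,
    Submodule.mem_sup, Submodule.mem_smul_pointwise_iff_exists]
  constructor
  · rintro ⟨_, ⟨_, ⟨f, hf, rfl⟩, _, ⟨_, ⟨g, hg, rfl⟩, _, ⟨h, hh, rfl⟩, rfl⟩, rfl⟩, u, hu, rfl⟩
    exact ⟨f, hf, g, hg, h, hh, u, hu, by module⟩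
  · rintro ⟨f, hf, g, hg, h, hh, u, hu, rfl⟩
    exact ⟨_, ⟨_, ⟨f, hf, rfl⟩, _, ⟨_, ⟨g, hg, rfl⟩, _, ⟨h, hh, rfl⟩, rfl⟩, rfl⟩, u, hu, by module⟩

theorem initialRegular_of_defect_singleton_eq_zero (h : IsAdapted U F [x])
    (hs : IsSuperficialSeq [x] U F) (hd : defect U F [x] = 0) : InitialRegular F x := by
  have h0 : ∀ n, gapLoss U F x [] n = 0 := by
    have h1 := (add_eq_zero.1 ((defect_cons h).symm.trans hd)).2
    exact fun n ↦ le_antisymm (h1 ▸ (enat_summable _).le_tsum n fun _ _ ↦ zero_le) zero_le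
  exact InitialRegular.of_inter_le_one h.le hs.1 fun n m hm ↦
    mem_ofList_singleton_smul_sup.1 (mem_of_gapLoss_eq_zero (h0 n) hm)

theorem initialRegular_of_gapLoss_pair_eq_zero (h : IsAdapted U F [x, y])
    (hs : IsSuperficialSeq [x, y] U F) (hd : ∀ n, gapLoss U F x [y] n = 0) :
    InitialRegular F x :=
  InitialRegular.of_inter_le_two h.zero h.le (h.smul_mem y (by simp)) hs.1 hs.2.2.1 fun n m hm ↦
    mem_ofList_pair_smul_sup.1 (mem_of_gapLoss_eq_zero (hd n) hm)

/-- The length of the socle, in degree `n`, of `⨁ M / F n` with respect to `y` and `z`. -/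
noncomputable def socleLength (F : ℕ → Submodule A M) (y z : A) (n : ℕ) : ℕ∞ :=
  relLength ((F (n + 1)).comap (LinearMap.lsmul A M y) ⊓ (F (n + 1)).comap (LinearMap.lsmul A M z))
    (F n)

/-- On the kernel of `y` in `⨁ M / F n`, multiplication by `z` raises the degree by one. Its kernel
is the socle, and its cokernel embeds, through multiplication by `y`, into the module whose length
is `gapLoss`. Kernel and cokernel lengths are compared by telescoping. -/
theorem sum_socleLength_le (h : IsAdapted U F [y, z]) (hs : IsSuperficialSeq [y, z] U F) (N : ℕ) :
    ∑ n ∈ Finset.range N, socleLength F y z n ≤ ∑' n, gapLoss U F y [z] n := by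
  have hy := h.smul_mem y (by simp)
  have hz := h.smul_mem z (by simp)
  let L (n : ℕ) : Submodule A M := (F (n + 1)).comap (LinearMap.lsmul A M y)
  let C (n : ℕ) : Submodule A M := (L n).map (LinearMap.lsmul A M z) ⊔ F (n + 1)
  have hFL (n : ℕ) : F n ≤ L n := fun m hm ↦ hy n m hm
  have hCL (n : ℕ) : C n ≤ L (n + 1) := by
    refine sup_le ?_ (hFL _)
    rintro _ ⟨m, hm, rfl⟩
    change y • z • m ∈ F (n + 2)
    rw [smul_comm]
    exact hz _ _ hm
  -- The exact sequence of `z` is written additively, since lengths may be infinite and cannot be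
  -- subtracted.
  have hstep (n : ℕ) : relLength (L (n + 1)) (F (n + 1)) + socleLength F y z n =
      relLength (L n) (F n) + relLength (L (n + 1)) (C n) := by
    rw [relLength_add (hCL n) le_sup_right, relLength_map_sup, ← relLength_inf (L n),
      relLength_add (X := L n) (Y := L n ⊓ (F (n + 1)).comap (LinearMap.lsmul A M z)) (Z := F n)
        inf_le_left (le_inf (hFL n) fun m hm ↦ hz n m hm)]
    change _ + relLength _ _ = _
    ring
  have hsum : relLength (L N) (F N) + ∑ n ∈ Finset.range N, socleLength F y z n =
      ∑ n ∈ Finset.range N, relLength (L (n + 1)) (C n) := by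
    induction N with
    | zero =>
      simp only [Finset.range_zero, Finset.sum_empty, add_zero]
      rw [relLength_eq_zero_iff, h.zero]
      exact le_top
    | succ N ih =>
      rw [Finset.sum_range_succ, Finset.sum_range_succ, ← ih, add_comm _ (socleLength F y z N),
        ← add_assoc, hstep]
      ring
  have hle (n : ℕ) : relLength (L (n + 1)) (C n) ≤ gapLoss U F y [z] (n + 1) := by
    set Y := Ideal.ofList [y, z] • F (n + 1) ⊔ U with hY
    have h1 : relLength ((L (n + 1)).map (LinearMap.lsmul A M y) ⊔ Y) Y ≤
        gapLoss U F y [z] (n + 1) := by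
      refine relLength_mono (sup_le ?_ (le_inf (h.ofList_smul_le _) le_sup_left)) _
      rintro _ ⟨m, hm, rfl⟩
      exact ⟨hm, (le_sup_right : y • (⊤ : Submodule A M) ≤ _)
        (Submodule.smul_mem_pointwise_smul _ _ _ Submodule.mem_top)⟩
    refine le_trans ?_ h1
    -- It remains that `y • m ∈ Y` forces `m ∈ C n`: regularity of `z` modulo `y`, then of `y`,
    -- rewrites the relation as a Koszul syzygy.
    rw [relLength_map_sup]
    refine relLength_anti _ ?_
    rintro m ⟨-, hm⟩
    obtain ⟨f, hf, g, hg, u, hu, he⟩ := mem_ofList_pair_smul_sup.1 (show y • m ∈ Y from hm)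
    obtain ⟨u', hu', w, hw⟩ := mem_sup_smul_top.1 (hs.2.2.1 g (mem_sup_smul_top.2
      ⟨-u, neg_mem hu, m - f, by rw [smul_sub, he]; module⟩))
    have hwL : w ∈ L n := by
      change y • w ∈ F (n + 1)
      have : y • w = g - u' := by rw [hw]; module
      rw [this]
      exact sub_mem hg (h.le _ hu')
    have h2 : m - f - z • w ∈ U := by
      refine hs.1 _ ?_
      have : y • (m - f - z • w) = z • u' + u := by
        rw [smul_sub, smul_sub, he, hw]; module
      rw [this]
      exact add_mem (U.smul_mem _ hu') hu
    have : m = z • w + (f + (m - f - z • w)) := by module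
    rw [this]
    exact Submodule.add_mem_sup (Submodule.mem_map_of_mem (f := LinearMap.lsmul A M z) hwL)
      (add_mem hf (h.le _ h2))
  calc ∑ n ∈ Finset.range N, socleLength F y z n
      ≤ relLength (L N) (F N) + ∑ n ∈ Finset.range N, socleLength F y z n := le_add_self
    _ ≤ ∑ n ∈ Finset.range N, gapLoss U F y [z] (n + 1) := by
        rw [hsum]
        exact Finset.sum_le_sum fun n _ ↦ hle n
    _ ≤ ∑ n ∈ Finset.range (N + 1), gapLoss U F y [z] n := by
        rw [Finset.sum_range_succ']
        exact le_self_add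
    _ ≤ ∑' n, gapLoss U F y [z] n := (enat_summable _).sum_le_tsum _ fun _ _ ↦ zero_le

theorem exists_eq_zero_of_sum_le_one {e : ℕ → ℕ∞} (h : ∀ N, ∑ n ∈ Finset.range N, e n ≤ 1) :
    ∃ p, e p ≤ 1 ∧ ∀ n ≠ p, e n = 0 := by
  have h1 : ∀ n, e n ≤ 1 := fun n ↦
    le_trans (Finset.single_le_sum (f := e) (fun _ _ ↦ zero_le)
      (Finset.mem_range.2 (Nat.lt_succ_self n))) (h (n + 1))
  by_cases hp : ∃ p, e p ≠ 0
  · obtain ⟨p, hp⟩ := hp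
    refine ⟨p, h1 p, fun n hn ↦ ?_⟩
    have h2 : e n + e p ≤ 1 := by
      rw [← Finset.sum_pair hn]
      refine le_trans (Finset.sum_le_sum_of_subset (t := Finset.range (n + p + 1)) ?_) (h _)
      intro i hi
      simp only [Finset.mem_insert, Finset.mem_singleton] at hi
      rw [Finset.mem_range]
      omega
    by_contra hn0
    have h3 : (1 : ℕ∞) + 1 ≤ e n + e p :=
      add_le_add (Order.one_le_iff_pos.2 (pos_iff_ne_zero.2 hn0))
        (Order.one_le_iff_pos.2 (pos_iff_ne_zero.2 hp))
    exact absurd (h3.trans h2) (by decide)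
  · push Not at hp
    exact ⟨0, h1 0, fun n _ ↦ hp n⟩

/-- Supplies the hypotheses of `InitialRegular.of_socle_simple`: vanishing losses at `x` give its
syzygies, and the bound on the losses at `y` gives the simple socle. -/
theorem initialRegular_of_gapLoss_triple_eq_zero [IsLocalRing A] [IsNoetherian A M]
    (h : IsAdapted U F [x, y, z]) (hs : IsSuperficialSeq [x, y, z] U F)
    (hd : ∀ n, gapLoss U F x [y, z] n = 0)
    (hd' : ∑' n, gapLoss (U ⊔ x • ⊤) (quotFiltration F x) y [z] n ≤ 1) :
    InitialRegular F x := by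
  have hx := h.smul_mem x (by simp)
  have hy := h.smul_mem y (by simp)
  have hz := h.smul_mem z (by simp)
  obtain ⟨p, hp, hp'⟩ := exists_eq_zero_of_sum_le_one fun N ↦
    (sum_socleLength_le h.quot hs.2.2 N).trans hd'
  refine InitialRegular.of_socle_simple h.zero hx hy hz ?_ hs.2.1 p ?_ ?_ ?_
  · intro n m hm
    obtain ⟨f, hf, g, hg, h', hh, u, hu, he⟩ :=
      mem_ofList_triple_smul_sup.1 (mem_of_gapLoss_eq_zero (hd (n + 1)) hm)
    -- The relation `x(m - f) = y g + z h' + u` is resolved by regularity of `z` modulo `x, y`, then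
    -- `y` modulo `x`, then `x`. The elements `w, g₁, h₁` are the resulting Koszul coefficients.
    obtain ⟨v, hv, w, hw⟩ := mem_sup_smul_top.1 (hs.2.2.2.2.1 h' (mem_sup_smul_top.2
      ⟨x • (m - f) - u, mem_sup_smul_top.2 ⟨-u, neg_mem hu, m - f, by module⟩, -g, by
        rw [smul_sub, he]; module⟩))
    obtain ⟨u', hu', h₁, hv'⟩ := mem_sup_smul_top.1 hv
    obtain ⟨u'', hu'', g₁, hg'⟩ := mem_sup_smul_top.1 (hs.2.2.1 (g + z • w) (mem_sup_smul_top.2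
      ⟨-u - z • u', sub_mem (neg_mem hu) (U.smul_mem _ hu'), m - f - z • h₁, by
        have e1 : x • m = x • f + y • g + z • (u' + x • h₁ + y • w) + u := by rw [he, hw, hv']
        rw [smul_sub, smul_sub, e1]; module⟩))
    have hU : m - f - y • g₁ - z • h₁ ∈ U := by
      refine hs.1 _ ?_
      have : x • (m - f - y • g₁ - z • h₁) = u + y • u'' + z • u' := by
        have e1 : x • m = x • f + y • g + z • (u' + x • h₁ + y • w) + u := by rw [he, hw, hv']
        have e2 : x • g₁ = g + z • w - u'' := by rw [hg']; module
        have e3 : x • (m - f - y • g₁ - z • h₁) =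
          x • m - x • f - y • x • g₁ - z • x • h₁ := by module
        rw [e3, e2, e1]; module
      rw [this]
      exact add_mem (add_mem hu (U.smul_mem _ hu'')) (U.smul_mem _ hu')
    refine ⟨w, g₁, h₁, ?_, ?_, ?_⟩
    · have : z • w - x • g₁ = u'' - g := by
        have : z • w = u'' + x • g₁ - g := by rw [← hg']; module
        rw [this]; module
      rw [this]
      exact sub_mem (h.le _ hu'') hg
    · have : y • w + x • h₁ = h' - u' := by rw [hw, hv']; module
      rw [this]
      exact sub_mem hh (h.le _ hu')
    · have : m - y • g₁ - z • h₁ = f + (m - f - y • g₁ - z • h₁) := by module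
      rw [this]
      exact add_mem hf (h.le _ hU)
  · intro n hn w hw hw'
    exact relLength_eq_zero_iff.1 (hp' n hn) ⟨hw, hw'⟩
  · intro w w₀ h1 h2 h3 h4 h5
    exact exists_smul_sub_mem_of_relLength_le_one hp ⟨h1, h2⟩ ⟨h3, h4⟩ h5
  · intro a ha w h1 h2
    exact smul_mem_of_relLength_le_one hp ha ⟨h1, h2⟩

theorem gapLoss_eq_zero_of_defect_le (h : IsAdapted U F (x :: xs)) (hfin : defect U F (x :: xs) ≠ ⊤)
    (hle : defect U F (x :: xs) ≤ defect (U ⊔ x • ⊤) (quotFiltration F x) xs) (n : ℕ) :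
    gapLoss U F x xs n = 0 := by
  have h1 := defect_cons h
  have h2 : ∑' n, gapLoss U F x xs n = 0 := by
    rw [h1] at hle hfin
    have h3 : defect (U ⊔ x • ⊤) (quotFiltration F x) xs ≠ ⊤ :=
      ne_top_of_le_ne_top hfin le_self_add
    have h4 := (ENat.add_le_add_iff_left h3).1 (hle.trans (add_zero _).ge)
    exact le_antisymm h4 (zero_le)
  exact le_antisymm (h2 ▸ (enat_summable _).le_tsum n fun _ _ ↦ zero_le) (zero_le)

/-- Either the strict inequality persists modulo `x` and descent applies, or the defect is unchanged
modulo `x`. The bound 2 then leaves only two or three generators. -/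
theorem initialRegular_of_defect_lt [IsLocalRing A] [IsNoetherian A M] :
    ∀ (xs : List A) (x : A) (U : Submodule A M) (F : ℕ → Submodule A M)
      (_ : IsAdapted U F (x :: xs)) (_ : IsSuperficialSeq (x :: xs) U F)
      (_ : defect U F (x :: xs) ≤ 2) (_ : defect U F (x :: xs) < xs.length + 1),
      InitialRegular F x := by
  intro xs
  induction xs with
  | nil =>
    intro x U F h hs _ hlt
    exact initialRegular_of_defect_singleton_eq_zero h hs (by simpa using hlt)
  | cons y ys ih =>
    intro x U F h hs h2 hlt
    have hsally := InitialRegular.head_of_quotFiltration h.zero (h.smul_mem x (by simp))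
      (h.smul_mem y (by simp)) hs.2.1
    have hle : defect (U ⊔ x • ⊤) (quotFiltration F x) (y :: ys) ≤ defect U F (x :: y :: ys) := by
      rw [defect_cons h]
      exact le_self_add
    by_cases hcase : defect (U ⊔ x • ⊤) (quotFiltration F x) (y :: ys) < ys.length + 1
    · exact hsally (ih y _ _ h.quot hs.2.2 (hle.trans h2) hcase)
    rw [not_lt] at hcase
    have hfin : defect U F (x :: y :: ys) ≠ ⊤ := ne_top_of_le_ne_top (by decide) h2
    have hge : defect U F (x :: y :: ys) ≤ ys.length + 1 := by
      rw [List.length_cons, Nat.cast_add, Nat.cast_one] at hlt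
      exact Order.le_of_lt_add_one hlt
    have hloss := gapLoss_eq_zero_of_defect_le h hfin (hge.trans hcase)
    match ys, hs, h, hsally, hle, hcase, hge, hloss, hlt, h2, hfin with
    | [], hs, h, hsally, hle, hcase, hge, hloss, hlt, h2, hfin =>
      exact initialRegular_of_gapLoss_pair_eq_zero h hs hloss
    | [z], hs, h, hsally, hle, hcase, hge, hloss, hlt, h2, hfin =>
      have hd' : defect (U ⊔ x • ⊤) (quotFiltration F x) [y, z] = 2 := by
        refine le_antisymm (hle.trans h2) ?_
        simpa [one_add_one_eq_two] using hcase
      have hfin' : defect (U ⊔ x • ⊤) (quotFiltration F x) [y, z] ≠ ⊤ := by rw [hd']; decide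
      have hcons := defect_cons h.quot
      rw [hd'] at hcons
      set d := defect (U ⊔ x • ⊤ ⊔ y • ⊤) (quotFiltration (quotFiltration F x) y) [z] with hd
      have hd2 : d ≤ 2 := hcons ▸ le_self_add
      by_cases hd0 : d = 0
      · refine hsally (InitialRegular.head_of_quotFiltration h.quot.zero
          (h.quot.smul_mem y (by simp)) (h.quot.smul_mem z (by simp)) hs.2.2.2.1 ?_)
        exact initialRegular_of_defect_singleton_eq_zero h.quot.quot hs.2.2.2.2 hd0
      by_cases hd22 : d = 2
      · refine hsally (initialRegular_of_gapLoss_pair_eq_zero h.quot hs.2.2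
          (gapLoss_eq_zero_of_defect_le h.quot hfin' ?_))
        rw [hd', ← hd22]
      -- Here `d = 1`, so the losses at `y` add up to 1.
      · refine initialRegular_of_gapLoss_triple_eq_zero h hs hloss ?_
        by_contra hgt
        rw [not_le] at hgt
        have h3 : (1 : ℕ∞) + 2 ≤ 2 := by
          conv_rhs => rw [hcons]
          exact add_le_add (Order.one_le_iff_pos.2 (pos_iff_ne_zero.2 hd0))
            (by simpa [one_add_one_eq_two] using Order.add_one_le_of_lt hgt)
        exact absurd h3 (by decide)
    | z :: w :: zs, hs, h, hsally, hle, hcase, hge, hloss, hlt, h2, hfin =>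
      have h3 : ((zs.length + 3 : ℕ) : ℕ∞) ≤ (2 : ℕ) := by
        refine le_trans ?_ ((hcase.trans hle).trans h2)
        simp only [List.length_cons]
        push_cast
        exact le_of_eq (by ring)
      rw [Nat.cast_le] at h3
      omega

end Defect

end AssocGraded

/-! ### Existence of superficial elements and sequences -/

namespace AssocGraded

open Pointwise Polynomial

section Avoidance

variable {A : Type*} [CommRing A] [IsLocalRing A]

/-- Over a local ring with infinite residue field, finitely many proper submodules do not cover a
finitely generated module. -/
theorem exists_notMem_of_finite_of_ne_top [Infinite (ResidueField A)] {E : Type*} [AddCommGroup E]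
    [Module A E] [Module.Finite A E] {ι : Type*} (s : Finset ι) (p : ι → Submodule A E)
    (hp : ∀ i ∈ s, p i ≠ ⊤) : ∃ v, ∀ i ∈ s, v ∉ p i := by
  by_contra! hcon
  have hcov : ⋃ i ∈ s, (p i : Set E) = Set.univ := by
    ext v
    simpa using hcon v
  -- In a finite cover by subgroups some member has finite index (B. H. Neumann). A simple quotient
  -- of `E ⧸ p i` would then be a finite residue field.
  obtain ⟨i, hi, hfi⟩ := Submodule.exists_finiteIndex_of_cover hcov
  have hfin : Finite (E ⧸ p i) := AddSubgroup.finite_quotient_of_finiteIndex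
  obtain ⟨N, hN, hle⟩ := (eq_top_or_exists_le_coatom (p i)).resolve_left (hp i hi)
  have hfin' : Finite (E ⧸ N) := Finite.of_surjective _ (Submodule.factor_surjective hle)
  have : IsSimpleModule A (E ⧸ N) := isSimpleModule_iff_isCoatom.2 hN
  obtain ⟨I, hI, ⟨e⟩⟩ := isSimpleModule_iff_quot_maximal.1 this
  obtain rfl := IsLocalRing.eq_maximalIdeal hI
  have : Finite (ResidueField A) := Finite.of_equiv _ e.toEquiv
  exact not_finite (ResidueField A)

end Avoidance

section Superficial

variable {A M : Type*} [CommRing A] [AddCommGroup M] [Module A M]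

/-- The filtration shifted by one. -/
def shiftFiltration {b : Ideal A} (F : b.Filtration M) : b.Filtration M where
  N n := F.N (n + 1)
  mono n := F.mono (n + 1)
  smul_le n := F.smul_le (n + 1)

/-- The elements of `F n` whose initial form is killed by that of `x`. -/
def colonFiltration {b : Ideal A} (F : b.Filtration M) (x : A) : b.Filtration M where
  N n := F.N n ⊓ (F.N (n + 2)).comap (LinearMap.lsmul A M x)
  mono n := inf_le_inf (F.mono n) (Submodule.comap_mono (F.mono (n + 2)))
  smul_le n := by
    rw [Submodule.smul_le]
    rintro r hr m ⟨h1, h2⟩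
    refine ⟨F.smul_le n (Submodule.smul_mem_smul hr h1), ?_⟩
    change x • r • m ∈ F.N (n + 3)
    rw [smul_comm]
    exact F.smul_le (n + 2) (Submodule.smul_mem_smul hr h2)

/-- The element `r t` of the Rees algebra. -/
noncomputable def reesDegreeOne (b : Ideal A) : b →ₗ[A] reesAlgebra b where
  toFun r := ⟨monomial 1 (r : A), reesAlgebra.monomial_mem.2 (by simp)⟩
  map_add' r s := Subtype.ext (by simp)
  map_smul' c r := Subtype.ext (by simp [smul_monomial])

theorem monomial_mem_span_reesDegreeOne_pow (b : Ideal A) (k : ℕ) (r : A) (hr : r ∈ b ^ k)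
    (h : monomial k r ∈ reesAlgebra b) :
    (⟨monomial k r, h⟩ : reesAlgebra b) ∈ Ideal.span (Set.range (reesDegreeOne b)) ^ k := by
  induction k generalizing r with
  | zero => simp
  | succ k ih =>
    rw [pow_succ'] at hr
    induction hr using Submodule.mul_induction_on' with
    | mem_mul_mem r hr s hs =>
      have h1 : (⟨monomial (k + 1) (r * s), h⟩ : reesAlgebra b) =
          reesDegreeOne b ⟨r, hr⟩ * ⟨monomial k s, reesAlgebra.monomial_mem.2 hs⟩ := by
        refine Subtype.ext ?_
        change monomial (k + 1) (r * s) = monomial 1 r * monomial k s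
        rw [monomial_mul_monomial, add_comm 1 k]
      rw [h1, pow_succ']
      exact Ideal.mul_mem_mul (Ideal.subset_span ⟨_, rfl⟩) (ih s hs _)
    | add r hr s hs h1 h2 =>
      have h3 : (⟨monomial (k + 1) (r + s), h⟩ : reesAlgebra b) =
          ⟨monomial (k + 1) r, reesAlgebra.monomial_mem.2 (by rwa [pow_succ'])⟩ +
          ⟨monomial (k + 1) s, reesAlgebra.monomial_mem.2 (by rwa [pow_succ'])⟩ :=
        Subtype.ext (by simp)
      rw [h3]
      exact add_mem (h1 _) (h2 _)

variable [IsLocalRing A] [IsNoetherianRing A] [Infinite (ResidueField A)] [Module.Finite A M]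

/-- Existence of superficial elements, as combinations of given generators. -/
theorem exists_superficial {d : ℕ} (y : Fin (d + 1) → A) {b : Ideal A}
    (hb : b = Ideal.span (Set.range y)) (F : b.Filtration M) (hF : F.Stable) :
    ∃ l : Fin (d + 1) → A, (∃ j, IsUnit (l j)) ∧
      ∃ n₀, ∀ n ≥ n₀, ∀ m ∈ F.N n, (∑ j, l j * y j) • m ∈ F.N (n + 2) → m ∈ F.N (n + 1) := by
  classical
  have hyb (j : Fin (d + 1)) : y j ∈ b := hb ▸ Ideal.subset_span ⟨j, rfl⟩
  let R := reesAlgebra b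
  let Q' : Submodule R (PolynomialModule A M) := (shiftFiltration F).submodule
  -- This is the associated graded module `⨁ F n / F (n + 1)` over the Rees algebra.
  let G : Submodule R (PolynomialModule A M ⧸ Q') := F.submodule.map Q'.mkQ
  have hfgF : F.submodule.FG :=
    (F.submodule_fg_iff_stable fun i ↦ IsNoetherian.noetherian _).2 hF
  have hfgG : G.FG := hfgF.map _
  have hGfin : Module.Finite R G := Module.Finite.iff_fg.2 hfgG
  have hGnoeth : IsNoetherian R G := isNoetherian_of_isNoetherianRing_of_finite R G
  let T : (Fin (d + 1) → A) →ₗ[A] b :=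
    { toFun := fun l ↦ ⟨∑ j, l j * y j, sum_mem fun j _ ↦ b.mul_mem_left _ (hyb j)⟩
      map_add' := fun l l' ↦ Subtype.ext (by simp [add_mul, Finset.sum_add_distrib])
      map_smul' := fun c l ↦ Subtype.ext (by
        change ∑ j, (c • l) j * y j = c * ∑ j, l j * y j
        simp [mul_assoc, Finset.mul_sum]) }
  let τ : (Fin (d + 1) → A) →ₗ[A] R := (reesDegreeOne b).comp T
  have hspan : ∀ P : Ideal R, (∀ l, τ l ∈ P) → Ideal.span (Set.range (reesDegreeOne b)) ≤ P := by
    intro P hP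
    rw [Ideal.span_le]
    rintro _ ⟨⟨r, hr⟩, rfl⟩
    have hr' := hr
    rw [hb] at hr'
    obtain ⟨l, hl⟩ := (Ideal.mem_span_range_iff_exists_fun).1 hr'
    have h1 : τ l = reesDegreeOne b ⟨r, hr⟩ := by
      change reesDegreeOne b (T l) = _
      congr 1
      exact Subtype.ext hl
    exact h1 ▸ hP l
  let S : Finset (Ideal R) := (associatedPrimes.finite R G).toFinset.filter
    fun P ↦ ¬ ∀ l, τ l ∈ P
  -- The extra index `none` forces a unit coefficient, so that the superficial element can replace a
  -- generator. The others avoid the associated primes of `G` that do not contain the whole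
  -- degree-one part.
  let p : Option (Ideal R) → Submodule A (Fin (d + 1) → A)
    | none => Submodule.pi Set.univ fun _ ↦ maximalIdeal A
    | some P => (P.restrictScalars A).comap τ
  obtain ⟨l, hl⟩ := exists_notMem_of_finite_of_ne_top (insert none (S.image some)) p (by
    intro i hi
    rcases Finset.mem_insert.1 hi with rfl | hi
    · intro h
      have h1 : (fun _ ↦ 1 : Fin (d + 1) → A) ∈ p none := h ▸ Submodule.mem_top
      exact (Ideal.ne_top_iff_one _).1 (maximalIdeal.isMaximal A).ne_top (h1 0 trivial)
    · obtain ⟨P, hP, rfl⟩ := Finset.mem_image.1 hi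
      intro h
      refine (Finset.mem_filter.1 hP).2 fun l ↦ ?_
      have h1 : l ∈ p (some P) := h ▸ Submodule.mem_top
      exact h1)
  refine ⟨l, ?_, ?_⟩
  · by_contra! hcon
    exact hl none (Finset.mem_insert_self _ _) fun j _ ↦ (mem_maximalIdeal _).2 (hcon j)
  set x := ∑ j, l j * y j with hx
  let H := colonFiltration F x
  have hHF : H ≤ F := fun n ↦ inf_le_left
  have hH : H.Stable := hF.of_le hHF
  let K : Submodule R (PolynomialModule A M ⧸ Q') := H.submodule.map Q'.mkQ
  have hKG : K ≤ G := Submodule.map_mono fun f hf n ↦ hHF n (hf n)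
  have hKfin : Module.Finite R K := Module.Finite.iff_fg.2
    (((H.submodule_fg_iff_stable fun i ↦ IsNoetherian.noetherian _).2 hH).map _)
  have hτ : τ l ∈ Module.annihilator R K := by
    rw [Module.mem_annihilator]
    rintro ⟨_, f, hf, rfl⟩
    refine Subtype.ext ?_
    change τ l • Q'.mkQ f = 0
    rw [← map_smul, Submodule.mkQ_apply, Submodule.Quotient.mk_eq_zero]
    intro n
    change (monomial 1 x • f).coeff n ∈ F.N (n + 1)
    rw [PolynomialModule.monomial_smul_apply]
    split_ifs with hn
    · have h1 : x • f.coeff (n - 1) ∈ F.N (n - 1 + 2) := (hf (n - 1)).2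
      have h2 : n - 1 + 2 = n + 1 := by omega
      rwa [h2] at h1
    · exact zero_mem _
  -- Minimal primes over the annihilator of `K` are associated to `G` and contain the form of `x`.
  -- By the choice of `l` they contain the degree-one part, a power of which therefore kills `K`.
  have hrad : Ideal.span (Set.range (reesDegreeOne b)) ≤ (Module.annihilator R K).radical := by
    rw [← Ideal.sInf_minimalPrimes]
    refine le_sInf fun P hP ↦ hspan P ?_
    have hass := Module.associatedPrimes.minimalPrimes_annihilator_subset_associatedPrimes R K hP
    have hassG : P ∈ associatedPrimes R G :=
      associatedPrimes.subset_of_injective (f := Submodule.inclusion hKG)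
        (Submodule.inclusion_injective hKG) hass
    by_contra hcon
    refine hl (some P) (Finset.mem_insert_of_mem (Finset.mem_image_of_mem _ (Finset.mem_filter.2
      ⟨(associatedPrimes.finite R G).mem_toFinset.2 hassG, hcon⟩))) ?_
    exact hP.1.2 hτ
  obtain ⟨k, hk⟩ := Ideal.exists_pow_le_of_le_radical_of_fg hrad (IsNoetherian.noetherian _)
  obtain ⟨n₀, hn₀⟩ := hH.exists_pow_smul_eq
  refine ⟨n₀ + k, fun n hn m hm hxm ↦ ?_⟩
  obtain ⟨j, rfl⟩ : ∃ j, n = n₀ + j + k := ⟨n - n₀ - k, by omega⟩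
  -- Stability of `H` makes elements of large degree multiples by `b ^ k`, which vanish in `G`.
  have hmH : m ∈ b ^ k • H.N (n₀ + j) := by
    have h1 : m ∈ H.N (n₀ + (k + j)) := by
      have h2 : n₀ + (k + j) = n₀ + j + k := by ring
      rw [h2]
      exact ⟨hm, hxm⟩
    rwa [hn₀, pow_add, mul_smul, ← hn₀] at h1
  refine Submodule.smul_induction_on hmH (fun r hr m' hm' ↦ ?_) fun _ _ ↦ add_mem
  have h1 := hk (monomial_mem_span_reesDegreeOne_pow b k r hr (reesAlgebra.monomial_mem.2 hr))
  rw [Module.mem_annihilator] at h1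
  have h2 : PolynomialModule.single A (n₀ + j) m' ∈ H.submodule := by
    intro i
    rw [PolynomialModule.coeff_single, Finsupp.single_apply]
    split_ifs with hi
    · exact hi ▸ hm'
    · exact zero_mem _
  have h3 := congrArg Subtype.val (h1 ⟨_, Submodule.mem_map_of_mem h2⟩)
  change (⟨monomial k r, reesAlgebra.monomial_mem.2 hr⟩ : R) • Q'.mkQ _ = 0 at h3
  rw [← map_smul, Submodule.mkQ_apply, Submodule.Quotient.mk_eq_zero] at h3
  have h4 : (monomial k r • PolynomialModule.single A (n₀ + j) m').coeff (n₀ + j + k) ∈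
    F.N (n₀ + j + k + 1) := h3 _
  rw [PolynomialModule.monomial_smul_single, PolynomialModule.coeff_single, add_comm k,
    Finsupp.single_eq_same] at h4
  exact h4

end Superficial

end AssocGraded

namespace AssocGraded

open Pointwise

variable {A M : Type*} [CommRing A] [AddCommGroup M] [Module A M]

/-- By the Artin–Rees lemma, a superficial element which is regular is initial regular in large
degrees. -/
theorem eventuallyInitialRegular_of_superficial [IsNoetherianRing A] [Module.Finite A M]
    {b : Ideal A} (F : b.Filtration M) (hF : F.Stable) (h0 : F.N 0 = ⊤) {x : A}
    (hreg : ∀ m : M, x • m = 0 → m = 0) {n₀ : ℕ}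
    (hsup : ∀ n ≥ n₀, ∀ m ∈ F.N n, x • m ∈ F.N (n + 2) → m ∈ F.N (n + 1)) :
    EventuallyInitialRegular F.N x := by
  have hpow : ∀ k, b ^ k • (⊤ : Submodule A M) ≤ F.N k := fun k ↦ by
    simpa [h0] using F.pow_smul_le k 0
  obtain ⟨k, hk⟩ :=
    (hF.inter_right (F' := b.trivialFiltration (x • (⊤ : Submodule A M)))).exists_pow_smul_eq
  -- Artin–Rees puts `x • m` in `x • b ^ j M`, and `x` cancels: the order of `m` drops by at most
  -- the constant `k`.
  have har : ∀ j m, x • m ∈ F.N (k + j) → m ∈ F.N j := by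
    intro j m hm
    have h1 : x • m ∈ (F ⊓ b.trivialFiltration (x • (⊤ : Submodule A M))).N (k + j) :=
      ⟨hm, Submodule.smul_mem_pointwise_smul _ _ _ Submodule.mem_top⟩
    rw [hk] at h1
    have h2 : x • m ∈ b ^ j • x • (⊤ : Submodule A M) :=
      (smul_mono_right (b ^ j) inf_le_right : _ ≤ b ^ j • x • (⊤ : Submodule A M)) h1
    rw [← Submodule.ideal_span_singleton_smul, ← mul_smul, mul_comm, mul_smul,
      Submodule.ideal_span_singleton_smul] at h2
    obtain ⟨m', hm', he⟩ := (Submodule.mem_smul_pointwise_iff_exists _ _ _).1 h2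
    have h3 : m' - m = 0 := hreg _ (by rw [smul_sub, he, sub_self])
    rw [← sub_eq_zero.1 h3]
    exact hpow j hm'
  refine ⟨n₀ + k, fun n hn m hm ↦ ?_⟩
  -- Once `m` lies in degree `n₀`, superficiality raises its degree one step at a time.
  have hclimb : ∀ i, n₀ + i ≤ n → m ∈ F.N (n₀ + i) := by
    intro i
    induction i with
    | zero =>
      intro _
      exact har n₀ m (F.antitone (by omega) hm)
    | succ i ih =>
      intro hi
      exact hsup (n₀ + i) (by omega) m (ih (by omega))
        (F.antitone (show n₀ + i + 2 ≤ n + 1 by omega) hm)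
  have := hclimb (n - n₀) (by omega)
  rwa [Nat.add_sub_cancel' (by omega)] at this

/-- Each member of the list is regular modulo the preceding ones. -/
def IsRegularMod : List A → Submodule A M → Prop
  | [], _ => True
  | x :: xs, U => (∀ m, x • m ∈ U → m ∈ U) ∧ IsRegularMod xs (U ⊔ x • ⊤)

theorem span_range_eq_sup_of_isUnit {d : ℕ} (y l : Fin (d + 1) → A) {j : Fin (d + 1)}
    (hj : IsUnit (l j)) : Ideal.span (Set.range y) =
      Ideal.span {∑ i, l i * y i} ⊔ Ideal.span (Set.range fun i ↦ y (j.succAbove i)) := by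
  apply le_antisymm
  · rw [Ideal.span_le]
    rintro _ ⟨i, rfl⟩
    rcases Fin.eq_self_or_eq_succAbove j i with rfl | ⟨i, rfl⟩
    · have h1 : l i * y i = ∑ i, l i * y i - ∑ k, l (i.succAbove k) * y (i.succAbove k) := by
        rw [Fin.sum_univ_succAbove _ i, add_sub_cancel_right]
      have h2 : l i * y i ∈ Ideal.span {∑ i, l i * y i} ⊔
          Ideal.span (Set.range fun k ↦ y (i.succAbove k)) := by
        rw [h1]
        refine sub_mem (Ideal.mem_sup_left (Ideal.mem_span_singleton_self _))
          (Ideal.mem_sup_right (sum_mem fun k _ ↦ Ideal.mul_mem_left _ _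
            (Ideal.subset_span ⟨k, rfl⟩)))
      exact (Ideal.unit_mul_mem_iff_mem _ hj).1 h2
    · exact Ideal.mem_sup_right (Ideal.subset_span ⟨i, rfl⟩)
  · refine sup_le ?_ (Ideal.span_mono ?_)
    · rw [Ideal.span_singleton_le_iff_mem]
      exact sum_mem fun i _ ↦ Ideal.mul_mem_left _ _ (Ideal.subset_span ⟨i, rfl⟩)
    · rintro _ ⟨i, rfl⟩
      exact ⟨_, rfl⟩

variable [IsLocalRing A] [IsNoetherianRing A] [Infinite (ResidueField A)] [Module.Finite A M]

/-- Applies the two preceding facts to the filtration induced on `M ⧸ U`, where it is stable. -/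
theorem exists_eventuallyInitialRegular {d : ℕ} (y : Fin (d + 1) → A) {U : Submodule A M}
    {F : ℕ → Submodule A M} (h0 : F 0 = ⊤) (hF : Antitone F) (hU : ∀ n, U ≤ F n)
    (hle : ∀ n, Ideal.span (Set.range y) • F n ≤ F (n + 1))
    (hst : ∃ n₀, ∀ n ≥ n₀, Ideal.span (Set.range y) • F n ⊔ U = F (n + 1))
    (hreg : ∀ l : Fin (d + 1) → A, (∃ j, IsUnit (l j)) → ∀ m, (∑ j, l j * y j) • m ∈ U → m ∈ U) :
    ∃ l : Fin (d + 1) → A, (∃ j, IsUnit (l j)) ∧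
      EventuallyInitialRegular F (∑ j, l j * y j) := by
  set b := Ideal.span (Set.range y) with hb
  let F' : b.Filtration (M ⧸ U) :=
    { N := fun n ↦ (F n).map U.mkQ
      mono := fun n ↦ Submodule.map_mono (hF n.le_succ)
      smul_le := fun n ↦ by
        rw [← Submodule.map_smul'']
        exact Submodule.map_mono (hle n) }
  have hF' : F'.Stable := by
    obtain ⟨n₀, hn₀⟩ := hst
    refine ⟨n₀, fun n hn ↦ ?_⟩
    change b • (F n).map U.mkQ = (F (n + 1)).map U.mkQ
    rw [← hn₀ n hn, Submodule.map_sup, ← Submodule.map_smul'', Submodule.mkQ_map_self, sup_bot_eq]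
  have hmem : ∀ n m, U.mkQ m ∈ F'.N n ↔ m ∈ F n := by
    intro n m
    refine ⟨?_, Submodule.mem_map_of_mem⟩
    rintro ⟨m', hm', he⟩
    have h1 : m' - m ∈ U := (Submodule.Quotient.eq U).1 he
    have : m = m' - (m' - m) := by abel
    rw [this]
    exact sub_mem hm' (hU n h1)
  obtain ⟨l, hl, n₀, hn₀⟩ := exists_superficial y hb F' hF'
  refine ⟨l, hl, ?_⟩
  obtain ⟨n₁, hn₁⟩ := eventuallyInitialRegular_of_superficial F' hF'
    (by change (F 0).map U.mkQ = ⊤; rw [h0, Submodule.map_top, Submodule.range_mkQ])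
    (x := ∑ j, l j * y j) (by
      intro m hm
      obtain ⟨m, rfl⟩ := U.mkQ_surjective m
      rw [← map_smul, Submodule.mkQ_apply, Submodule.Quotient.mk_eq_zero] at hm
      rw [Submodule.mkQ_apply, Submodule.Quotient.mk_eq_zero]
      exact hreg l hl m hm) hn₀
  refine ⟨n₁, fun n hn m hm ↦ ?_⟩
  rw [← hmem]
  refine hn₁ n hn _ ?_
  rw [← map_smul]
  exact (hmem _ _).2 hm

/-- Existence of superficial sequences generating a given ideal. -/
theorem exists_isSuperficialSeq (d : ℕ) : ∀ (y : Fin d → A) (U : Submodule A M)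
    (F : ℕ → Submodule A M) (_ : F 0 = ⊤) (_ : Antitone F) (_ : ∀ n, U ≤ F n)
    (_ : ∀ n, Ideal.span (Set.range y) • F n ≤ F (n + 1))
    (_ : ∃ n₀, ∀ n ≥ n₀, Ideal.span (Set.range y) • F n ⊔ U = F (n + 1))
    (_ : ∀ xs : List A, xs.length = d → Ideal.ofList xs = Ideal.span (Set.range y) →
      IsRegularMod xs U),
    ∃ xs : List A, xs.length = d ∧ Ideal.ofList xs = Ideal.span (Set.range y) ∧
      IsSuperficialSeq xs U F := by
  induction d with
  | zero =>
    intro y U F _ _ _ _ _ _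
    exact ⟨[], rfl, by simp, trivial⟩
  | succ d ih =>
    intro y U F h0 hF hU hle hst hreg
    have hcons : ∀ (l : Fin (d + 1) → A) (j : Fin (d + 1)), IsUnit (l j) → ∀ xs : List A,
        Ideal.ofList xs = Ideal.span (Set.range fun i ↦ y (j.succAbove i)) →
        Ideal.ofList ((∑ i, l i * y i) :: xs) = Ideal.span (Set.range y) := by
      intro l j hj xs hxs
      rw [Ideal.ofList_cons, hxs, span_range_eq_sup_of_isUnit y l hj]
    have hlist : ∀ j : Fin (d + 1),
        Ideal.ofList (List.ofFn fun i ↦ y (j.succAbove i)) =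
          Ideal.span (Set.range fun i ↦ y (j.succAbove i)) := by
      intro j
      rw [Ideal.ofList]
      congr 1
      ext a
      simp [List.mem_ofFn]
    obtain ⟨l, ⟨j, hj⟩, hl⟩ := exists_eventuallyInitialRegular y h0 hF hU hle hst (by
      rintro l ⟨j, hj⟩
      exact (hreg (_ :: List.ofFn fun i ↦ y (j.succAbove i)) (by simp)
        (hcons l j hj _ (hlist j))).1)
    set x := ∑ i, l i * y i with hx
    set b' := Ideal.span (Set.range fun i ↦ y (j.succAbove i)) with hb'
    have hb : Ideal.span (Set.range y) = Ideal.span {x} ⊔ b' := span_range_eq_sup_of_isUnit y l hj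
    have hbF : ∀ n, Ideal.span (Set.range y) • F n = x • F n ⊔ b' • F n := fun n ↦ by
      rw [hb, Submodule.sup_smul, Submodule.ideal_span_singleton_smul]
    have hxt : ∀ X : Submodule A M, x • X ≤ x • ⊤ := fun X ↦ smul_mono_right _ le_top
    have hbt : b' • x • (⊤ : Submodule A M) ≤ x • ⊤ := Submodule.smul_le_right
    obtain ⟨xs, hlen, hxs, hsup⟩ := ih (fun i ↦ y (j.succAbove i)) (U ⊔ x • ⊤)
      (quotFiltration F x) (by rw [quotFiltration, h0, top_sup_eq])
      (fun m n hmn ↦ sup_le_sup_right (hF hmn) _) (fun n ↦ sup_le_sup_right (hU n) _)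
      (fun n ↦ by
        rw [quotFiltration, quotFiltration, Submodule.smul_sup]
        exact sup_le_sup (le_trans (by rw [hbF]; exact le_sup_right) (hle n)) hbt)
      (by
        obtain ⟨n₀, hn₀⟩ := hst
        refine ⟨n₀, fun n hn ↦ ?_⟩
        rw [quotFiltration, quotFiltration, Submodule.smul_sup, ← hn₀ n hn, hbF]
        apply le_antisymm
        · refine sup_le (sup_le ?_ (hbt.trans le_sup_right)) (sup_le ?_ le_sup_right)
          · exact (le_sup_right.trans le_sup_left).trans le_sup_left
          · exact le_sup_right.trans le_sup_left
        · refine sup_le (sup_le (sup_le ?_ ?_) ?_) ?_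
          · exact (hxt _).trans (le_sup_right.trans le_sup_right)
          · exact le_sup_left.trans le_sup_left
          · exact le_sup_left.trans le_sup_right
          · exact le_sup_right.trans le_sup_right)
      -- Regularity is assumed for every generating list of the given length, so it survives the
      -- change of generators.
      (fun xs hlen hxs ↦ (hreg (x :: xs) (by simp [hlen]) (hcons l j hj xs hxs)).2)
    refine ⟨x :: xs, by simp [hlen], hcons l j hj xs hxs, ?_, hl, hsup⟩
    exact (hreg (x :: xs) (by simp [hlen]) (hcons l j hj xs hxs)).1

end AssocGraded

/-! ### Depth, dimension, and parameters on Cohen–Macaulay modules -/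

namespace AssocGraded

open Pointwise RingTheory.Sequence

section Depth

universe u v

open CategoryTheory Abelian ModuleCat in
-- Depth drops by at most one modulo `x`: it is detected by vanishing of `Ext` from the residue
-- field, and the long exact sequence of multiplication by `x` shifts the range by one.
theorem exists_isRegular_quotSMulTop_of_small {A : Type u} [CommRing A] [IsLocalRing A]
    [IsNoetherianRing A] [Small.{v} A] (M : Type v) [AddCommGroup M] [Module A M]
    [Module.Finite A M] [Nontrivial M] {x : A} (hx : x ∈ maximalIdeal A) (hreg : IsSMulRegular M x)
    {n : ℕ} (h : ∃ rs : List A, rs.length = n + 1 ∧ (∀ r ∈ rs, r ∈ maximalIdeal A) ∧ IsRegular M rs) :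
    ∃ rs : List A, rs.length = n ∧ (∀ r ∈ rs, r ∈ maximalIdeal A) ∧
      IsRegular (QuotSMulTop x M) rs := by
  have hlt : ∀ (L : Type v) [AddCommGroup L] [Module A L] [Module.Finite A L] [Nontrivial L],
      maximalIdeal A • (⊤ : Submodule A L) < ⊤ := fun L _ _ _ _ ↦
    lt_top_iff_ne_top.2 (Submodule.top_ne_ideal_smul_of_le_jacobson_annihilator
      (maximalIdeal_le_jacobson _)).symm
  have : Nontrivial (QuotSMulTop x M) := nontrivial_quotSMulTop_of_mem_maximalIdeal M hx
  let k : ModuleCat.{v} A := ModuleCat.of A (Shrink.{v} (A ⧸ maximalIdeal A))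
  have hext : ∀ i < n + 1, Subsingleton (Ext k (ModuleCat.of A M) i) :=
    ((exists_isRegular_tfae (maximalIdeal A) (n + 1) (ModuleCat.of A M) (hlt M)).out 3 1).1 h
  refine ((exists_isRegular_tfae (maximalIdeal A) n (ModuleCat.of A (QuotSMulTop x M))
    (hlt _)).out 1 3).1 fun i hi ↦ ?_
  have zero1 := AddCommGrpCat.isZero_of_iff_subsingleton.mpr (hext i (by omega))
  have zero2 := AddCommGrpCat.isZero_of_iff_subsingleton.mpr (hext (i + 1) (by omega))
  have hreg' : IsSMulRegular (ModuleCat.of A M) x := hreg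
  exact AddCommGrpCat.subsingleton_of_isZero <| ShortComplex.Exact.isZero_of_both_zeros
    ((Ext.covariant_sequence_exact₃' k hreg'.smulShortComplex_shortExact) i (i + 1) rfl)
    (zero1.eq_zero_of_src _) (zero2.eq_zero_of_tgt _)

theorem exists_isRegular_quotSMulTop {A : Type u} [CommRing A] [IsLocalRing A]
    [IsNoetherianRing A] (M : Type v) [AddCommGroup M] [Module A M]
    [Module.Finite A M] [Nontrivial M] {x : A} (hx : x ∈ maximalIdeal A) (hreg : IsSMulRegular M x)
    {n : ℕ} (h : ∃ rs : List A, rs.length = n + 1 ∧ (∀ r ∈ rs, r ∈ maximalIdeal A) ∧ IsRegular M rs) :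
    ∃ rs : List A, rs.length = n ∧ (∀ r ∈ rs, r ∈ maximalIdeal A) ∧
      IsRegular (QuotSMulTop x M) rs := by
  let e : ULift.{u} M ≃ₗ[A] M := ULift.moduleEquiv
  obtain ⟨rs, hlen, hmem, hrs⟩ := h
  have : Module.Finite A (ULift.{u} M) := Module.Finite.equiv e.symm
  obtain ⟨ss, hlen', hmem', hss⟩ := exists_isRegular_quotSMulTop_of_small (ULift.{u} M) hx
    ((e.isSMulRegular_congr x).2 hreg) (n := n)
    ⟨rs, hlen, hmem, (e.isRegular_congr rs).2 hrs⟩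
  exact ⟨ss, hlen', hmem', ((QuotSMulTop.congr x e).isRegular_congr ss).1 hss⟩

end Depth

section CohenMacaulay

variable {A : Type*} [CommRing A] [IsLocalRing A] [IsNoetherianRing A]

/-- The length of a regular sequence is at most the dimension of any associated prime. -/
theorem length_le_supportDim_of_mem_associatedPrimes (rs : List A) :
    ∀ {M : Type*} [AddCommGroup M] [Module A M] [Module.Finite A M]
      (_ : ∀ r ∈ rs, r ∈ maximalIdeal A) (_ : IsRegular M rs) (p : Ideal A)
      (_ : p ∈ associatedPrimes A M), (rs.length : WithBot ℕ∞) ≤ Module.supportDim A (A ⧸ p) := by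
  induction rs with
  | nil =>
    intro M _ _ _ _ _ p hp
    have := (IsAssociatedPrime.isPrime hp)
    have : Nontrivial (A ⧸ p) := Ideal.Quotient.nontrivial_iff.2 this.ne_top
    rw [List.length_nil, Nat.cast_zero, Module.supportDim]
    have := Module.nonempty_support_of_nontrivial (R := A) (M := A ⧸ p)
    have := this.to_subtype
    exact Order.krullDim_nonneg
  | cons y ys ih =>
    intro M _ _ _ hmem hreg p hp
    have hym : y ∈ maximalIdeal A := hmem y (by simp)
    rw [isRegular_cons_iff] at hreg
    have hprime := IsAssociatedPrime.isPrime hp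
    obtain ⟨-, v, hv⟩ := isAssociatedPrime_iff.1 hp
    have hv0 : v ≠ 0 := by
      rintro rfl
      exact hprime.ne_top (by rw [hv]; simp)
    have hyv : y ∉ p := by
      intro h
      rw [hv, Submodule.mem_colon_singleton, Submodule.mem_bot] at h
      exact hv0 (hreg.1.right_eq_zero_of_smul h)
    -- the submodule of elements killed by `p`, and its image modulo `y`
    let K : Submodule A M := Submodule.torsionBySet A M p
    let K' : Submodule A (QuotSMulTop y M) := K.map (Submodule.mkQ _)
    have hvK : v ∈ K := by
      rw [Submodule.mem_torsionBySet_iff]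
      rintro ⟨a, ha⟩
      have ha' : a ∈ p := ha
      rw [hv, Submodule.mem_colon_singleton, Submodule.mem_bot] at ha'
      exact ha'
    have hK' : Nontrivial K' := by
      rw [Submodule.nontrivial_iff_ne_bot]
      intro hbot
      have hle : K ≤ y • (⊤ : Submodule A M) := by
        rw [← Submodule.ker_mkQ (y • (⊤ : Submodule A M))]
        exact LinearMap.le_ker_iff_map.2 hbot
      -- If `y • w` is killed by `p` then so is `w`, as `y` is regular. Thus `K ≤ yM` would give `K
      -- = yK`, excluded by Nakayama, and an associated prime of `K'` contains both `p` and `y`.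
      have hK : K ≤ maximalIdeal A • K := by
        intro m hm
        obtain ⟨w, -, rfl⟩ := (Submodule.mem_smul_pointwise_iff_exists _ _ _).1 (hle hm)
        refine Submodule.smul_mem_smul hym ?_
        rw [Submodule.mem_torsionBySet_iff] at hm ⊢
        intro a
        refine hreg.1.right_eq_zero_of_smul ?_
        rw [smul_comm]
        exact hm a
      have h0 := Submodule.eq_bot_of_le_smul_of_le_jacobson_bot (maximalIdeal A) K
        (IsNoetherian.noetherian _) hK (maximalIdeal_le_jacobson _)
      rw [h0] at hvK
      exact hv0 hvK
    obtain ⟨q, hq⟩ := associatedPrimes.nonempty A K'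
    have hq' := associatedPrimes.subset_of_injective (f := K'.subtype) K'.injective_subtype hq
    have hqann := IsAssociatedPrime.annihilator_le hq
    have hpq : p ≤ q := by
      intro a ha
      refine hqann ?_
      rw [Submodule.annihilator_top, Module.mem_annihilator]
      rintro ⟨_, m, hm, rfl⟩
      refine Subtype.ext ?_
      change a • Submodule.mkQ _ m = 0
      rw [← map_smul]
      have := (Submodule.mem_torsionBySet_iff _ _).1 hm ⟨a, ha⟩
      change a • m = 0 at this
      rw [this, map_zero]
    have hyq : y ∈ q := by
      refine hqann ?_
      rw [Submodule.annihilator_top, Module.mem_annihilator]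
      rintro ⟨_, m, hm, rfl⟩
      refine Subtype.ext ?_
      change y • Submodule.mkQ _ m = 0
      rw [← map_smul, Submodule.mkQ_apply, Submodule.Quotient.mk_eq_zero]
      exact Submodule.smul_mem_pointwise_smul _ _ _ Submodule.mem_top
    have h1 := ih (fun r hr ↦ hmem r (by simp [hr])) hreg.2 q hq'
    have hyreg : IsSMulRegular (A ⧸ p) y := by
      rw [isSMulRegular_iff_right_eq_zero_of_smul]
      intro w hw
      obtain ⟨w, rfl⟩ := Ideal.Quotient.mk_surjective w
      have h2 : y * w ∈ p := Ideal.Quotient.eq_zero_iff_mem.1 hw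
      exact Ideal.Quotient.eq_zero_iff_mem.2 ((hprime.mem_or_mem h2).resolve_left hyv)
    rw [← Module.supportDim_quotSMulTop_succ_eq_supportDim hyreg hym, List.length_cons,
      Nat.cast_add, Nat.cast_one]
    gcongr
    refine h1.trans ?_
    let g : (A ⧸ p) →ₗ[A] (A ⧸ q) := Submodule.factor hpq
    have hg : y • (⊤ : Submodule A (A ⧸ p)) ≤ LinearMap.ker g := by
      intro w hw
      obtain ⟨w, -, rfl⟩ := (Submodule.mem_smul_pointwise_iff_exists _ _ _).1 hw
      rw [LinearMap.mem_ker, map_smul]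
      obtain ⟨a, ha⟩ := Ideal.Quotient.mk_surjective (g w)
      rw [← ha]
      exact Ideal.Quotient.eq_zero_iff_mem.2 (q.mul_mem_right a hyq)
    refine Module.supportDim_le_of_surjective ((y • (⊤ : Submodule A (A ⧸ p))).liftQ g hg) ?_
    intro w
    obtain ⟨w, rfl⟩ := Submodule.factor_surjective hpq w
    exact ⟨Submodule.Quotient.mk w, rfl⟩

/-- Each parameter lowers the dimension by at most one, and what remains is supported at the maximal
ideal. -/
theorem supportDim_le_length (ys : List A) : ∀ {N : Type*} [AddCommGroup N] [Module A N]
    [Module.Finite A N] (_ : ∀ y ∈ ys, y ∈ maximalIdeal A)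
    (_ : ∀ q : Ideal A, q.IsPrime → Module.annihilator A N ≤ q → (∀ y ∈ ys, y ∈ q) →
      q = maximalIdeal A), Module.supportDim A N ≤ ys.length := by
  induction ys with
  | nil =>
    intro N _ _ _ _ h
    rw [List.length_nil, Nat.cast_zero, Module.supportDim]
    have : Subsingleton (Module.support A N) := by
      refine ⟨fun p q ↦ Subtype.ext (PrimeSpectrum.ext ?_)⟩
      rw [h _ p.1.2 (Module.mem_support_iff_of_finite.1 p.2) (by simp),
        h _ q.1.2 (Module.mem_support_iff_of_finite.1 q.2) (by simp)]
    exact Order.krullDim_nonpos_of_subsingleton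
  | cons y ys ih =>
    intro N _ _ _ hmem h
    refine (Module.supportDim_le_supportDim_quotSMulTop_succ (hmem y (by simp))).trans ?_
    rw [List.length_cons, Nat.cast_add, Nat.cast_one]
    gcongr
    refine ih (fun z hz ↦ hmem z (by simp [hz])) fun q hq hann hys ↦ ?_
    have hyq : y ∈ q := by
      refine hann (Module.mem_annihilator.2 fun w ↦ ?_)
      obtain ⟨w, rfl⟩ := Submodule.mkQ_surjective _ w
      rw [← map_smul, Submodule.mkQ_apply, Submodule.Quotient.mk_eq_zero]
      exact Submodule.smul_mem_pointwise_smul _ _ _ Submodule.mem_top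
    refine h q hq (le_trans ?_ hann) (by simpa using ⟨hyq, hys⟩)
    exact (Submodule.mkQ _).annihilator_le_of_surjective (Submodule.mkQ_surjective _)

/-- Over a module with a regular sequence of length `r`, each system of parameters of length `r` is
weakly regular. -/
theorem isWeaklyRegular_of_parameters (xs : List A) :
    ∀ {M : Type*} [AddCommGroup M] [Module A M] [Module.Finite A M] [Nontrivial M]
      (_ : ∃ rs : List A, rs.length = xs.length ∧ (∀ r ∈ rs, r ∈ maximalIdeal A) ∧ IsRegular M rs)
      (_ : ∀ x ∈ xs, x ∈ maximalIdeal A)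
      (_ : ∀ q : Ideal A, q.IsPrime → Module.annihilator A M ≤ q → (∀ x ∈ xs, x ∈ q) →
        q = maximalIdeal A), IsWeaklyRegular M xs := by
  induction xs with
  | nil => intros; exact IsWeaklyRegular.nil A _
  | cons x xs ih =>
    intro M _ _ _ _ hdepth hmem h
    have hxm : x ∈ maximalIdeal A := hmem x (by simp)
    -- A zero divisor `x` lies in an associated prime `p`; then `xs` alone are parameters for `A ⧸
    -- p`, whose dimension would be smaller than the depth of `M`.
    have hreg : IsSMulRegular M x := by
      by_contra hnot
      have h1 : x ∈ ⋃ p ∈ associatedPrimes A M, (p : Set A) := by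
        rw [biUnion_associatedPrimes_eq_compl_regular]
        exact hnot
      simp only [Set.mem_iUnion, SetLike.mem_coe] at h1
      obtain ⟨p, hp, hxp⟩ := h1
      obtain ⟨rs, hlen, hrs, hreg⟩ := hdepth
      have h2 := length_le_supportDim_of_mem_associatedPrimes rs hrs hreg p hp
      have h3 : Module.supportDim A (A ⧸ p) ≤ xs.length := by
        refine supportDim_le_length xs (fun z hz ↦ hmem z (by simp [hz])) fun q hq hann hxs ↦ ?_
        rw [Ideal.annihilator_quotient] at hann
        have h4 := IsAssociatedPrime.annihilator_le hp
        rw [Submodule.annihilator_top] at h4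
        exact h q hq (h4.trans hann) (by simpa using ⟨hann hxp, hxs⟩)
      have h5 := h2.trans h3
      rw [hlen, List.length_cons, Nat.cast_le] at h5
      omega
    rw [isWeaklyRegular_cons_iff]
    have : Nontrivial (QuotSMulTop x M) := nontrivial_quotSMulTop_of_mem_maximalIdeal M hxm
    refine ⟨hreg, ih (exists_isRegular_quotSMulTop M hxm hreg hdepth)
      (fun z hz ↦ hmem z (by simp [hz])) fun q hq hann hxs ↦ ?_⟩
    have hxq : x ∈ q := by
      refine hann (Module.mem_annihilator.2 fun w ↦ ?_)
      obtain ⟨w, rfl⟩ := Submodule.mkQ_surjective _ w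
      rw [← map_smul, Submodule.mkQ_apply, Submodule.Quotient.mk_eq_zero]
      exact Submodule.smul_mem_pointwise_smul _ _ _ Submodule.mem_top
    refine h q hq (le_trans ?_ hann) (by simpa using ⟨hxq, hxs⟩)
    exact (Submodule.mkQ _).annihilator_le_of_surjective (Submodule.mkQ_surjective _)

end CohenMacaulay

section RegularMod

variable {A M : Type*} [CommRing A] [AddCommGroup M] [Module A M]

theorem isRegularMod_iff (xs : List A) : ∀ U : Submodule A M, IsRegularMod xs U ↔
    ∀ i (h : i < xs.length), ∀ m, xs[i] • m ∈ Ideal.ofList (xs.take i) • ⊤ ⊔ U →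
      m ∈ Ideal.ofList (xs.take i) • ⊤ ⊔ U := by
  induction xs with
  | nil => intro U; simp [IsRegularMod]
  | cons x xs ih =>
    intro U
    have key : ∀ i, Ideal.ofList ((x :: xs).take (i + 1)) • (⊤ : Submodule A M) ⊔ U =
        Ideal.ofList (xs.take i) • ⊤ ⊔ (U ⊔ x • ⊤) := by
      intro i
      rw [List.take_succ_cons, Ideal.ofList_cons_smul, sup_comm (x • _), sup_assoc,
        sup_comm U]
    rw [IsRegularMod, ih]
    constructor
    · rintro ⟨h0, h1⟩ i hi m hm
      cases i with
      | zero => simpa using h0 m (by simpa using hm)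
      | succ i =>
        rw [key] at hm ⊢
        exact h1 i (by simpa using hi) m hm
    · intro h
      refine ⟨fun m hm ↦ by simpa using h 0 (by simp) m (by simpa using hm), fun i hi m hm ↦ ?_⟩
      rw [← key] at hm ⊢
      exact h (i + 1) (by simpa using hi) m hm

theorem isRegularMod_bot_of_isWeaklyRegular {xs : List A} (h : IsWeaklyRegular M xs) :
    IsRegularMod xs (⊥ : Submodule A M) := by
  rw [isRegularMod_iff]
  intro i hi m hm
  rw [sup_bot_eq] at hm ⊢
  exact mem_of_isSMulRegular_quotient_of_smul_mem (h.regular_mod_prev i hi) hm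

end RegularMod

end AssocGraded

/-! ### From initial regular sequences to the associated graded module -/

namespace AssocGraded

open Pointwise RingTheory.Sequence

section InitialSeq

variable {A M : Type*} [CommRing A] [AddCommGroup M] [Module A M]

/-- Each member of the list is initial regular modulo the preceding ones. -/
def IsInitialRegularSeq : List A → (ℕ → Submodule A M) → Prop
  | [], _ => True
  | x :: xs, F => InitialRegular F x ∧ IsInitialRegularSeq xs (quotFiltration F x)

/-- The defect never grows modulo a generator, so the head result applies while more than `d`
generators remain. -/
theorem isInitialRegularSeq_take [IsLocalRing A] [IsNoetherian A M] (xs : List A) :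
    ∀ (U : Submodule A M) (F : ℕ → Submodule A M) (_ : IsAdapted U F xs)
      (_ : IsSuperficialSeq xs U F) (k d : ℕ) (_ : defect U F xs ≤ d) (_ : d ≤ 2)
      (_ : k + d ≤ xs.length), IsInitialRegularSeq (xs.take k) F := by
  induction xs with
  | nil => intros; simp [IsInitialRegularSeq]
  | cons x xs ih =>
    intro U F h hs k d hd h2 hk
    cases k with
    | zero => trivial
    | succ k =>
      rw [List.length_cons] at hk
      rw [List.take_succ_cons]
      refine ⟨initialRegular_of_defect_lt xs x U F h hs
        (hd.trans (by exact_mod_cast h2)) (hd.trans_lt ?_), ?_⟩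
      · have : d < xs.length + 1 := by omega
        exact_mod_cast this
      · refine ih _ _ h.quot hs.2.2 k d (le_trans ?_ hd) h2 (by omega)
        rw [defect_cons h]
        exact le_self_add

end InitialSeq

section Rees

variable {A M : Type*} [CommRing A] [AddCommGroup M] [Module A M] {a : Ideal A}

/-- The coefficient of an element of the Rees module. -/
noncomputable def reesCoeff (n : ℕ) : ReesModule a M →+ M where
  toFun p := p.1.coeff n
  map_zero' := rfl
  map_add' _ _ := rfl

theorem reesCoeff_mem (p : ReesModule a M) (n : ℕ) :
    reesCoeff n p ∈ (a ^ n • ⊤ : Submodule A M) :=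
  p.2 n

theorem reesModule_ext {p q : ReesModule a M} (h : ∀ n, reesCoeff n p = reesCoeff n q) : p = q :=
  Subtype.ext (PolynomialModule.coeff_injective (Finsupp.ext h))

/-- The homogeneous element of degree `n` of the Rees module with given coefficient. -/
noncomputable def reesSingle (n : ℕ) : ↥(a ^ n • ⊤ : Submodule A M) →+ ReesModule a M where
  toFun m := ⟨PolynomialModule.single A n m.1, fun i ↦ by
    rw [PolynomialModule.coeff_single, Finsupp.single_apply]
    split_ifs with h
    · exact h ▸ m.2
    · exact zero_mem _⟩
  map_zero' := Subtype.ext (PolynomialModule.single_zero n)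
  map_add' _ _ := Subtype.ext (PolynomialModule.single_add n _ _)

theorem reesCoeff_reesSingle (n i : ℕ) (m : ↥(a ^ n • ⊤ : Submodule A M)) :
    reesCoeff i (reesSingle n m) = if n = i then m.1 else 0 := by
  change (PolynomialModule.single A n m.1).coeff i = _
  rw [PolynomialModule.coeff_single, Finsupp.single_apply]

theorem sum_reesSingle (p : ReesModule a M) :
    ∑ n ∈ p.1.coeff.support, reesSingle n ⟨reesCoeff n p, reesCoeff_mem p n⟩ = p := by
  refine reesModule_ext fun i ↦ ?_
  rw [map_sum]
  simp only [reesCoeff_reesSingle]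
  rw [Finset.sum_ite_eq']
  split_ifs with h
  · rfl
  · exact (Finsupp.notMem_support_iff.1 h).symm

/-- The element `x t` of the Rees algebra. -/
noncomputable def reesT (x : a) : reesAlgebra a :=
  ⟨Polynomial.monomial 1 x.1, reesAlgebra.monomial_mem.2 (by rw [pow_one]; exact x.2)⟩

theorem reesCoeff_algebraMap_smul (r : A) (p : ReesModule a M) (n : ℕ) :
    reesCoeff n (algebraMap A (reesAlgebra a) r • p) = r • reesCoeff n p := by
  change ((Polynomial.monomial 0 r) • p.1).coeff n = _
  rw [PolynomialModule.monomial_smul_apply]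
  simp only [Nat.zero_le, if_true, Nat.sub_zero]
  rfl

theorem reesCoeff_reesT_smul_zero (x : a) (p : ReesModule a M) :
    reesCoeff 0 (reesT x • p) = 0 := by
  change ((Polynomial.monomial 1 x.1) • p.1).coeff 0 = _
  rw [PolynomialModule.monomial_smul_apply]
  simp

theorem reesCoeff_reesT_smul_succ (x : a) (p : ReesModule a M) (n : ℕ) :
    reesCoeff (n + 1) (reesT x • p) = x.1 • reesCoeff n p := by
  change ((Polynomial.monomial 1 x.1) • p.1).coeff (n + 1) = _
  rw [PolynomialModule.monomial_smul_apply]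
  simp only [Nat.le_add_left, if_true, Nat.add_sub_cancel]
  rfl

variable (M) in
theorem mem_map_smul_top_iff (p : ReesModule a M) :
    p ∈ (a.map (algebraMap A (reesAlgebra a)) • ⊤ :
      Submodule (reesAlgebra a) (ReesModule a M)) ↔
      ∀ n, reesCoeff n p ∈ (a ^ (n + 1) • ⊤ : Submodule A M) := by
  constructor
  · intro hp
    rw [Ideal.map] at hp
    refine Submodule.smul_induction_on hp (fun s hs q _ ↦ ?_) fun p q hp hq n ↦ ?_
    · induction hs using Submodule.span_induction generalizing q with
      | mem s hs =>
        obtain ⟨r, hr, rfl⟩ := hs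
        intro n
        rw [reesCoeff_algebraMap_smul, pow_succ', Submodule.mul_smul]
        exact Submodule.smul_mem_smul hr (reesCoeff_mem q n)
      | zero => intro n; rw [zero_smul, map_zero]; exact zero_mem _
      | add s t _ _ hs ht =>
        intro n
        rw [add_smul, map_add]
        exact add_mem (hs q trivial n) (ht q trivial n)
      | smul u s _ hs => rw [smul_assoc, smul_comm]; exact hs _ trivial
    · rw [map_add]
      exact add_mem (hp n) (hq n)
  · intro hp
    rw [← sum_reesSingle p]
    refine sum_mem fun n _ ↦ ?_
    have key : ∀ m (hm : m ∈ (a ^ n • ⊤ : Submodule A M)), m ∈ (a ^ (n + 1) • ⊤ : Submodule A M) →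
        reesSingle n ⟨m, hm⟩ ∈ (a.map (algebraMap A (reesAlgebra a)) • ⊤ :
          Submodule (reesAlgebra a) (ReesModule a M)) := by
      intro m hm h
      rw [pow_succ', Submodule.mul_smul] at h
      induction h using Submodule.smul_induction_on' with
      | smul r hr m hm' =>
        have : reesSingle n ⟨r • m, hm⟩ = algebraMap A (reesAlgebra a) r • reesSingle n ⟨m, hm'⟩ := by
          refine reesModule_ext fun i ↦ ?_
          rw [reesCoeff_algebraMap_smul, reesCoeff_reesSingle, reesCoeff_reesSingle, smul_ite,
            smul_zero]
        rw [this]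
        exact Submodule.smul_mem_smul (Ideal.mem_map_of_mem _ hr) trivial
      | add m₁ h₁ m₂ h₂ ih₁ ih₂ =>
        have hm₁ := (Submodule.smul_le_right : a • (a ^ n • ⊤ : Submodule A M) ≤ _) h₁
        have hm₂ := (Submodule.smul_le_right : a • (a ^ n • ⊤ : Submodule A M) ≤ _) h₂
        have := add_mem (ih₁ hm₁) (ih₂ hm₂)
        rwa [← map_add] at this
    exact key _ _ (hp n)

/-- The reason is `G(M) / x*G(M) ≅ G(M / xM)` for initial regular `x`, with `x*` its degree-one
form. Here `U` is the kernel of the Rees module mapping to the graded module of `M / W`. -/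
theorem isRegularMod_reesT (l : List a) : ∀ (W : Submodule A M)
    (U : Submodule (reesAlgebra a) (ReesModule a M))
    (_ : ∀ p, p ∈ U ↔ ∀ n, reesCoeff n p ∈ a ^ (n + 1) • ⊤ ⊔ W)
    (_ : IsInitialRegularSeq (l.map (↑)) fun n ↦ a ^ n • ⊤ ⊔ W),
    IsRegularMod (l.map reesT) U := by
  induction l with
  | nil => intros; trivial
  | cons x l ih =>
    intro W U hU h
    rw [List.map_cons] at h ⊢
    have hanti : ∀ {i j : ℕ}, i ≤ j → (a ^ j • ⊤ : Submodule A M) ≤ a ^ i • ⊤ := fun hij ↦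
      Submodule.smul_mono_left (Ideal.pow_le_pow_right hij)
    have hx : ∀ n, ∀ m ∈ (a ^ n • ⊤ : Submodule A M), x.1 • m ∈ (a ^ (n + 1) • ⊤ : Submodule A M) := by
      intro n m hm
      rw [pow_succ', Submodule.mul_smul]
      exact Submodule.smul_mem_smul x.2 hm
    refine ⟨fun p hp ↦ (hU p).2 fun n ↦ ?_, ih (W ⊔ x.1 • ⊤) _ (fun p ↦ ⟨fun hp n ↦ ?_, fun hp ↦ ?_⟩) ?_⟩
    · refine h.1 (n + 1) _ ?_
      rw [← reesCoeff_reesT_smul_succ]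
      exact (hU _).1 hp (n + 1)
    · obtain ⟨u, hu, q, rfl⟩ := mem_sup_smul_top.1 hp
      rw [map_add]
      have hW : (a ^ (n + 1) • ⊤ ⊔ W : Submodule A M) ≤ a ^ (n + 1) • ⊤ ⊔ (W ⊔ x.1 • ⊤) :=
        sup_le_sup_left le_sup_left _
      refine add_mem (hW ((hU u).1 hu n)) ?_
      cases n with
      | zero => rw [reesCoeff_reesT_smul_zero]; exact zero_mem _
      | succ n =>
        rw [reesCoeff_reesT_smul_succ]
        refine (le_sup_right.trans le_sup_right : x.1 • (⊤ : Submodule A M) ≤ _) ?_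
        exact Submodule.smul_mem_pointwise_smul _ _ _ trivial
    · have key : ∀ n, ∃ f ∈ (a ^ n • ⊤ : Submodule A M),
          reesCoeff (n + 1) p - x.1 • f ∈ (a ^ (n + 2) • ⊤ ⊔ W : Submodule A M) := by
        intro n
        have h1 := hp (n + 1)
        rw [← sup_assoc] at h1
        obtain ⟨g, hg, w, hw⟩ := mem_sup_smul_top.1 h1
        have h2 : w ∈ (a ^ n • ⊤ ⊔ W : Submodule A M) := by
          refine h.1 n w ?_
          rw [← sub_eq_iff_eq_add'.2 hw]
          exact sub_mem ((le_sup_left : (a ^ (n + 1) • ⊤ : Submodule A M) ≤ _) (reesCoeff_mem p _))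
            (sup_le_sup_right (hanti (by omega)) W hg)
        obtain ⟨f, hf, v, hv, rfl⟩ := Submodule.mem_sup.1 h2
        refine ⟨f, hf, ?_⟩
        have : reesCoeff (n + 1) p - x.1 • f = g + x.1 • v := by rw [hw]; module
        rw [this]
        exact add_mem hg ((le_sup_right : W ≤ _) (W.smul_mem _ hv))
      choose f hf hpf using key
      -- Only finitely many `f n` are used. The convention `Nat.pred 0 = 0` may add the term `f 0`,
      -- which is harmless since `hpf` holds in every degree.
      let q : ReesModule a M := ∑ n ∈ p.1.coeff.support.image Nat.pred, reesSingle n ⟨f n, hf n⟩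
      have hq : ∀ n, reesCoeff (n + 1) p - x.1 • reesCoeff n q ∈ (a ^ (n + 2) • ⊤ ⊔ W : Submodule A M) := by
        intro n
        have : reesCoeff n q = if n ∈ p.1.coeff.support.image Nat.pred then f n else 0 := by
          rw [map_sum]
          simp only [reesCoeff_reesSingle]
          rw [Finset.sum_ite_eq']
        rw [this]
        split_ifs with hn
        · exact hpf n
        · have h0 : reesCoeff (n + 1) p = 0 := by
            by_contra hne
            exact hn (Finset.mem_image.2 ⟨n + 1, Finsupp.mem_support_iff.2 hne, rfl⟩)
          rw [h0]
          simp
      refine mem_sup_smul_top.2 ⟨p - reesT x • q, (hU _).2 fun n ↦ ?_, q, by abel⟩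
      rw [map_sub]
      cases n with
      | zero =>
        rw [reesCoeff_reesT_smul_zero, sub_zero]
        -- In degree zero `xM` is already contained in `aM`.
        have hle : (a ^ 1 • ⊤ ⊔ (W ⊔ x.1 • ⊤) : Submodule A M) ≤ a ^ 1 • ⊤ ⊔ W := by
          refine sup_le le_sup_left (sup_le le_sup_right (le_trans ?_ le_sup_left))
          rintro _ ⟨m, -, rfl⟩
          exact hx 0 m (by simp)
        exact hle (hp 0)
      | succ n =>
        rw [reesCoeff_reesT_smul_succ]
        exact hq n
    · have h2 := h.2
      have e : quotFiltration (fun n ↦ (a ^ n • ⊤ ⊔ W : Submodule A M)) x.1 =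
          fun n ↦ a ^ n • ⊤ ⊔ (W ⊔ x.1 • ⊤) := funext fun n ↦ sup_assoc _ _ _
      rwa [e] at h2

end Rees

end AssocGraded

/-! ### Depth of the associated graded module and the theorem -/

namespace AssocGraded

open Pointwise RingTheory.Sequence

section GrDepth

variable {A M : Type*} [CommRing A] [AddCommGroup M] [Module A M]

theorem IsRegularMod.isWeaklyRegular {xs : List A} {U : Submodule A M} (h : IsRegularMod xs U) :
    IsWeaklyRegular (M ⧸ U) xs := by
  refine ⟨fun i hi ↦ .of_right_eq_zero_of_smul fun v hv ↦ ?_⟩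
  have hcomap : (Ideal.ofList (xs.take i) • ⊤ : Submodule A (M ⧸ U)).comap U.mkQ =
      Ideal.ofList (xs.take i) • ⊤ ⊔ U := by
    rw [← Submodule.range_mkQ U, LinearMap.range_eq_map, ← Submodule.map_smul'',
      Submodule.comap_map_mkQ, sup_comm]
  obtain ⟨w, rfl⟩ := Submodule.mkQ_surjective _ v
  obtain ⟨m, rfl⟩ := Submodule.mkQ_surjective _ w
  rw [← map_smul, ← map_smul, Submodule.mkQ_apply, Submodule.Quotient.mk_eq_zero,
    ← Submodule.mem_comap, hcomap] at hv
  rw [Submodule.mkQ_apply, Submodule.Quotient.mk_eq_zero, ← Submodule.mem_comap, hcomap]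
  exact (isRegularMod_iff xs U).1 h i hi m hv

variable {a : Ideal A}

theorem reesCoeff_zero_smul (s : reesAlgebra a) (p : ReesModule a M) :
    reesCoeff 0 (s • p) = s.1.coeff 0 • reesCoeff 0 p := by
  change (s.1 • p.1).coeff 0 = _
  rw [PolynomialModule.smul_apply]
  simp only [Finset.Nat.antidiagonal_zero, Finset.sum_singleton]
  rfl

theorem reesT_mem_reesMaxIdeal [IsLocalRing A] (x : a) : reesT x ∈ reesMaxIdeal a := by
  change (Polynomial.monomial 1 x.1).coeff 0 ∈ maximalIdeal A
  rw [Polynomial.coeff_monomial]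
  simp

theorem isWeaklyRegular_map_quotientMk {R N : Type*} [CommRing R] [AddCommGroup N] [Module R N]
    (I : Ideal R) {rs : List R} (h : IsWeaklyRegular (N ⧸ (I • ⊤ : Submodule R N)) rs) :
    IsWeaklyRegular (N ⧸ (I • ⊤ : Submodule R N)) (rs.map (Ideal.Quotient.mk I)) :=
  (isWeaklyRegular_map_algebraMap_iff (R ⧸ I) _ rs).2 h

theorem mem_sup_of_mk_mem_map_smul_top {R N : Type*} [CommRing R] [AddCommGroup N] [Module R N]
    {I J : Ideal R} {v : N ⧸ (I • ⊤ : Submodule R N)}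
    (hv : v ∈ (J.map (Ideal.Quotient.mk I) • ⊤ : Submodule (R ⧸ I) (N ⧸ (I • ⊤ : Submodule R N)))) :
    ∀ p : N, Submodule.Quotient.mk p = v → p ∈ (J • ⊤ ⊔ I • ⊤ : Submodule R N) := by
  have hker : ∀ p q : N, (Submodule.Quotient.mk p : N ⧸ (I • ⊤ : Submodule R N)) =
      Submodule.Quotient.mk q → q ∈ (J • ⊤ ⊔ I • ⊤ : Submodule R N) →
      p ∈ (J • ⊤ ⊔ I • ⊤ : Submodule R N) := by
    intro p q h hq
    have h1 : p - q ∈ (J • ⊤ ⊔ I • ⊤ : Submodule R N) :=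
      (le_sup_right : I • (⊤ : Submodule R N) ≤ _) ((Submodule.Quotient.eq _).1 h)
    simpa using add_mem h1 hq
  refine Submodule.smul_induction_on hv (fun g hg w _ p hp ↦ ?_) fun v w hv hw p hp ↦ ?_
  · obtain ⟨s, hs, rfl⟩ := (Ideal.mem_map_iff_of_surjective _ Ideal.Quotient.mk_surjective).1 hg
    obtain ⟨q, rfl⟩ := Submodule.Quotient.mk_surjective _ w
    exact hker p (s • q) hp ((le_sup_left : J • (⊤ : Submodule R N) ≤ _)
      (Submodule.smul_mem_smul hs trivial))
  · obtain ⟨q, rfl⟩ := Submodule.Quotient.mk_surjective _ v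
    obtain ⟨q', rfl⟩ := Submodule.Quotient.mk_surjective _ w
    exact hker p (q + q') hp (add_mem (hv q rfl) (hw q' rfl))

theorem length_le_idealGrade_quotient {R N : Type*} [CommRing R] [AddCommGroup N] [Module R N]
    {I J : Ideal R} {rs : List R} (hrs : ∀ y ∈ rs, y ∈ J)
    (hweak : IsWeaklyRegular (N ⧸ (I • ⊤ : Submodule R N)) rs)
    (hne : (J • ⊤ ⊔ I • ⊤ : Submodule R N) ≠ ⊤) :
    (rs.length : ℕ∞) ≤ idealGrade (J.map (Ideal.Quotient.mk I)) (N ⧸ (I • ⊤ : Submodule R N)) := by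
  have hmem : ∀ y ∈ rs.map (Ideal.Quotient.mk I), y ∈ J.map (Ideal.Quotient.mk I) := by
    intro y hy
    obtain ⟨x, hx, rfl⟩ := List.mem_map.1 hy
    exact Ideal.mem_map_of_mem _ (hrs x hx)
  refine le_trans (le_of_eq ?_) (le_iSup₂ (f := fun (rs : List (R ⧸ I)) (_ : (∀ y ∈ rs,
    y ∈ J.map (Ideal.Quotient.mk I)) ∧ IsRegular (N ⧸ (I • ⊤ : Submodule R N)) rs) ↦
    (rs.length : ℕ∞)) (rs.map (Ideal.Quotient.mk I))
    ⟨hmem, isWeaklyRegular_map_quotientMk I hweak, fun htop ↦ hne (top_le_iff.1 fun p _ ↦ ?_)⟩)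
  · rw [List.length_map]
  · have htop' : (⊤ : Submodule (R ⧸ I) (N ⧸ (I • ⊤ : Submodule R N))) ≤
        J.map (Ideal.Quotient.mk I) • ⊤ :=
      htop.le.trans (Submodule.smul_mono_left (Ideal.span_le.2 hmem))
    exact mem_sup_of_mk_mem_map_smul_top (htop' trivial) p rfl

theorem reesCoeff_zero_mem [IsLocalRing A] (ha : a ≤ maximalIdeal A) {p : ReesModule a M}
    (hp : p ∈ (reesMaxIdeal a • ⊤ ⊔ a.map (algebraMap A (reesAlgebra a)) • ⊤ :
      Submodule (reesAlgebra a) (ReesModule a M))) :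
    reesCoeff 0 p ∈ (maximalIdeal A • ⊤ : Submodule A M) := by
  obtain ⟨p, hp', q, hq, rfl⟩ := Submodule.mem_sup.1 hp
  rw [map_add]
  refine add_mem ?_ (Submodule.smul_mono_left ha ?_)
  · refine Submodule.smul_induction_on hp' (fun s hs q _ ↦ ?_) fun p q hp hq ↦ ?_
    · rw [reesCoeff_zero_smul]
      exact Submodule.smul_mem_smul hs trivial
    · rw [map_add]
      exact add_mem hp hq
  · have h1 := (mem_map_smul_top_iff M q).1 hq 0
    rwa [zero_add, pow_one] at h1

/-- The regular sequence also needs a nonzero final quotient. In degree zero this is `M ≠ mM`, that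
is, Nakayama. -/
theorem length_le_grDepth [IsLocalRing A] [Module.Finite A M] [Nontrivial M]
    (ha : a ≤ maximalIdeal A) (l : List a)
    (h : IsInitialRegularSeq (l.map (↑)) fun n ↦ (a ^ n • ⊤ : Submodule A M)) :
    (l.length : ℕ∞) ≤ grDepth a M := by
  have hweak : IsWeaklyRegular (GrModule a M) (l.map reesT) := by
    refine (isRegularMod_reesT (M := M) l ⊥ _ (fun p ↦ ?_) ?_).isWeaklyRegular
    · simp only [sup_bot_eq]
      exact mem_map_smul_top_iff M p
    · simpa only [sup_bot_eq] using h
  rw [← List.length_map (f := reesT) (as := l)]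
  refine length_le_idealGrade_quotient (J := reesMaxIdeal a) (fun y hy ↦ ?_) hweak fun htop ↦ ?_
  · obtain ⟨x, -, rfl⟩ := List.mem_map.1 hy
    exact reesT_mem_reesMaxIdeal x
  · refine Submodule.top_ne_ideal_smul_of_le_jacobson_annihilator (R := A) (M := M)
      (maximalIdeal_le_jacobson _) (top_le_iff.1 fun m _ ↦ ?_).symm
    have hm : m ∈ (a ^ 0 • ⊤ : Submodule A M) := by simp
    have := reesCoeff_zero_mem ha (htop.ge (trivial : reesSingle 0 ⟨m, hm⟩ ∈ ⊤))
    rwa [reesCoeff_reesSingle, if_pos rfl] at this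

end GrDepth

section Main

variable {A M : Type*} [CommRing A] [AddCommGroup M] [Module A M]

theorem exists_isRegular_of_idealGrade_eq [IsLocalRing A] [Nontrivial M] {r : ℕ}
    (h : idealGrade (maximalIdeal A) M = r) :
    ∃ rs : List A, rs.length = r ∧ (∀ y ∈ rs, y ∈ maximalIdeal A) ∧ IsRegular M rs := by
  cases r with
  | zero => exact ⟨[], rfl, by simp, IsRegular.nil A M⟩
  | succ r =>
    by_contra! hno
    have hle : idealGrade (maximalIdeal A) M ≤ r := by
      refine iSup₂_le fun rs hrs ↦ ?_
      have h1 : (rs.length : ℕ∞) ≤ (r + 1 : ℕ) := by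
        rw [← h]
        exact le_iSup₂ (f := fun (rs : List A) (_ : (∀ y ∈ rs, y ∈ maximalIdeal A) ∧
          IsRegular M rs) ↦ (rs.length : ℕ∞)) rs hrs
      have h2 : rs.length ≠ r + 1 := fun h2 ↦ hno rs h2 hrs.1 hrs.2
      rw [Nat.cast_le] at h1 ⊢
      omega
    rw [h, Nat.cast_le] at hle
    omega

/-- The chain of submodules `mᵏN` stabilizes by the Artinian condition, and Nakayama makes the
stable value zero. -/
theorem exists_pow_le_annihilator_of_isFiniteLength [IsLocalRing A] {N : Type*} [AddCommGroup N] [Module A N]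
    (h : IsFiniteLength A N) : ∃ k, maximalIdeal A ^ k ≤ Module.annihilator A N := by
  obtain ⟨_, _⟩ := isFiniteLength_iff_isNoetherian_isArtinian.1 h
  obtain ⟨k, hk⟩ := IsArtinian.monotone_stabilizes (R := A) (M := N)
    ⟨fun k ↦ OrderDual.toDual (maximalIdeal A ^ k • ⊤ : Submodule A N),
      fun i j hij ↦ Submodule.smul_mono_left (Ideal.pow_le_pow_right hij)⟩
  have hk' : (maximalIdeal A ^ k • ⊤ : Submodule A N) = maximalIdeal A ^ (k + 1) • ⊤ :=
    hk (k + 1) (by omega)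
  have hbot : (maximalIdeal A ^ k • ⊤ : Submodule A N) = ⊥ := by
    refine Submodule.eq_bot_of_le_smul_of_le_jacobson_bot (maximalIdeal A) _
      (IsNoetherian.noetherian _) ?_ (maximalIdeal_le_jacobson _)
    rw [← Submodule.mul_smul, ← pow_succ']
    exact hk'.le
  refine ⟨k, fun s hs ↦ Module.mem_annihilator.2 fun w ↦ ?_⟩
  rw [← Submodule.mem_bot A, ← hbot]
  exact Submodule.smul_mem_smul hs trivial

theorem smul_pow_smul_eq_of_le {c a : Ideal A} {n₀ : ℕ}
    (h : ((c * a ^ n₀) • ⊤ : Submodule A M) = a ^ (n₀ + 1) • ⊤) {n : ℕ} (hn : n₀ ≤ n) :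
    c • (a ^ n • ⊤ : Submodule A M) = a ^ (n + 1) • ⊤ := by
  obtain ⟨j, rfl⟩ := Nat.exists_eq_add_of_le hn
  rw [← Submodule.mul_smul, pow_add, ← mul_assoc, mul_comm, Submodule.mul_smul, h,
    ← Submodule.mul_smul, ← pow_add]
  congr 2
  omega

/-- A prime in the support of `M` which contains a reduction of an ideal of definition is the
maximal ideal. -/
theorem eq_maximalIdeal_of_reduction_le [IsLocalRing A] [Module.Finite A M] {c a q : Ideal A} [hq : q.IsPrime]
    (ha : IsIdealOfDefinition a M) (hc : IsReduction c a M) (hann : Module.annihilator A M ≤ q)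
    (hcq : c ≤ q) : q = maximalIdeal A := by
  have hsupp : ∀ I : Ideal A, I ≤ q → Module.annihilator A (M ⧸ (I • ⊤ : Submodule A M)) ≤ q := by
    intro I hI
    have : (⟨q, hq⟩ : PrimeSpectrum A) ∈ Module.support A (M ⧸ (I • ⊤ : Submodule A M)) := by
      rw [Module.support_quotient]
      exact ⟨Module.mem_support_iff_of_finite.2 hann, hI⟩
    exact Module.annihilator_le_of_mem_support this
  obtain ⟨n, hn⟩ := hc.2
  have haq : a ≤ q := by
    -- From `aⁿ⁺¹M = c aⁿM ⊆ cM`, the power `aⁿ⁺¹` annihilates `M / cM`, so it lies in `q`.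
    refine hq.le_of_pow_le (n := n + 1) (le_trans (fun s hs ↦ ?_) (hsupp c hcq))
    refine Module.mem_annihilator.2 fun w ↦ ?_
    obtain ⟨m, rfl⟩ := Submodule.Quotient.mk_surjective _ w
    rw [← Submodule.Quotient.mk_smul, Submodule.Quotient.mk_eq_zero]
    have h1 : s • m ∈ (a ^ (n + 1) • ⊤ : Submodule A M) := Submodule.smul_mem_smul hs trivial
    rw [← hn] at h1
    have h2 : ((c * a ^ n) • ⊤ : Submodule A M) ≤ c • ⊤ :=
      Submodule.smul_mono_left Ideal.mul_le_left
    exact h2 h1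
  obtain ⟨k, hk⟩ := exists_pow_le_annihilator_of_isFiniteLength ha.2
  exact le_antisymm (le_maximalIdeal hq.ne_top) (hq.le_of_pow_le (hk.trans (hsupp a haq)))

end Main

theorem delta_eq_defect {A M : Type*} [CommRing A] [AddCommGroup M] [Module A M] (a : Ideal A)
    (xs : List A) : delta a (Ideal.ofList xs) M = defect ⊥ (fun n ↦ (a ^ n • ⊤ : Submodule A M)) xs := by
  refine tsum_congr fun n ↦ ?_
  rw [gap, sup_bot_eq, sup_bot_eq, ← Submodule.mul_smul]
  rfl

end AssocGraded

theorem theorem4p1 {A : Type*} [CommRing A] [IsLocalRing A] [IsNoetherianRing A]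
    [Infinite (IsLocalRing.ResidueField A)]
    {M : Type*} [AddCommGroup M] [Module A M]
    (hM : AssocGraded.IsCohenMacaulay A M)
    (r : ℕ) (hr : Module.supportDim A M = r)
    (a : Ideal A) (ha : AssocGraded.IsIdealOfDefinition a M)
    (x : Fin r → A) (c : Ideal A) (hc : c = Ideal.span (Set.range x))
    (hmin : AssocGraded.IsMinimalReduction c a M)
    (hδ : AssocGraded.delta a c M ≤ 2) :
    (r : ℕ∞) - AssocGraded.delta a c M ≤ AssocGraded.grDepth a M := by
  open AssocGraded RingTheory.Sequence in
  have hfin := hM.finite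
  have hnt := hM.nontrivial
  have hred : IsReduction c a M := hmin.prop
  have ham : a ≤ maximalIdeal A := le_maximalIdeal ha.1
  have hgrade : idealGrade (maximalIdeal A) M = r := by
    have := hM.depth_eq_dim.trans hr
    exact_mod_cast this
  have hregular := exists_isRegular_of_idealGrade_eq hgrade
  have hsmul : ∀ n, c • (a ^ n • ⊤ : Submodule A M) ≤ a ^ (n + 1) • ⊤ := fun n ↦ by
    rw [pow_succ', Submodule.mul_smul]
    exact Submodule.smul_mono_left hred.1
  obtain ⟨xs, hlen, hxs, hsup⟩ := exists_isSuperficialSeq r x (⊥ : Submodule A M)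
    (fun n ↦ a ^ n • ⊤) (by simp) (fun i j hij ↦ Submodule.smul_mono_left (Ideal.pow_le_pow_right hij))
    (fun _ ↦ bot_le) (fun n ↦ hc ▸ hsmul n)
    (by
      obtain ⟨n₀, hn₀⟩ := hred.2
      refine ⟨n₀, fun n hn ↦ ?_⟩
      rw [sup_bot_eq, ← hc]
      exact smul_pow_smul_eq_of_le hn₀ hn)
    -- Any `r` generators of `c` are parameters for `M`, hence regular because the depth is `r`.
    (fun ys hys hyc ↦ by
      rw [← hc] at hyc
      have hyc' : ∀ y ∈ ys, y ∈ c := fun y hy ↦ hyc ▸ Ideal.subset_span hy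
      refine isRegularMod_bot_of_isWeaklyRegular (isWeaklyRegular_of_parameters ys
        (hys ▸ hregular) (fun y hy ↦ ham (hred.1 (hyc' y hy))) fun q hq hann hyq ↦ ?_)
      exact eq_maximalIdeal_of_reduction_le ha hred hann (hyc ▸ Ideal.span_le.2 hyq))
  rw [← hc] at hxs
  have hxa : ∀ y ∈ xs, y ∈ a := fun y hy ↦ hred.1 (hxs ▸ Ideal.subset_span hy)
  have hadapt : IsAdapted (⊥ : Submodule A M) (fun n ↦ a ^ n • ⊤) xs :=
    ⟨by simp, fun _ ↦ bot_le, fun y hy n m hm ↦ by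
      rw [pow_succ', Submodule.mul_smul]
      exact Submodule.smul_mem_smul (hxa y hy) hm⟩
  have hdelta : delta a c M = defect (⊥ : Submodule A M) (fun n ↦ a ^ n • ⊤) xs := by
    rw [← hxs, delta_eq_defect]
  obtain ⟨d, hd⟩ := ENat.ne_top_iff_exists.1 (ne_top_of_le_ne_top (by decide) hδ)
  rw [← hd] at hδ ⊢
  have hd2 : d ≤ 2 := by exact_mod_cast hδ
  by_cases hdr : d ≤ r
  · have hseq := isInitialRegularSeq_take xs _ _ hadapt hsup (r - d) d (hdelta ▸ hd.ge) hd2 (by omega)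
    lift xs to List a using hxa
    rw [← List.map_take] at hseq
    refine le_trans (le_of_eq ?_) (length_le_grDepth ham _ hseq)
    rw [List.length_map] at hlen
    rw [List.length_take, hlen, min_eq_left (by omega)]
    norm_cast
  -- When `δ > r` the truncated difference is zero.
  · rw [tsub_eq_zero_of_le (by exact_mod_cast (by omega : r ≤ d))]
    exact zero_le
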